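/- Let $g\ge 2$ and write $N=8g-4$; all indices are taken modulo $N$. Let $\Gamma$ be a discrete group of orientation-preserving isometries (Möbius transformations) of the hyperbolic disk $\mathbb D=\{|z|<1\}$ acting freely on $\mathbb D$, with $\Gamma\backslash\mathbb D$ a compact surface of genus $g$. Let $\mathcal F\subset\mathbb D$ be an $N$-sided fundamental polygon of $\Gamma$ with vertices $V_1,\dots,V_N$ in counterclockwise order, side $i$ being the geodesic segment from $V_i$ to $V_{i+1}$, such that the geodesic extension of each side never meets the interior of a translate $\gamma\mathcal F$, $\gamma\in\Gamma$ (the extension condition). Let $P_i$ and $Q_{i+1}$ be the initial and final endpoints on $\mathbb S=\partial\mathbb D$ of the oriented geodesic extending side $i$; their counterclockwise order on $\mathbb S$ is $P_1,Q_1,P_2,Q_2,\dots,P_N,Q_N$. Put $$\sigma(i)=\begin{cases}4g-i & i \text{ odd}\\ 2-i & i\text{ even}\end{cases}\pmod{N},\qquad \rho(i)=\sigma(i)+1,\qquad \tau(i)=i+(4g-2)\pmod N.$$ Assume that the sides are paired by generators $T_1,\dots,T_N$ of $\Gamma$, Möbius transformations with $T_i(V_i)=V_{\rho(i)}$, $T_{\sigma(i)}T_i=\mathrm{Id}$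 and $T_{\rho^3(i)}T_{\rho^2(i)}T_{\rho(i)}T_i=\mathrm{Id}$ for all $i$. **Proposition.** Let $\bar A=\{A_1,\dots,A_N\}$ be extremal, that is, $A_i\in\{P_i,Q_i\}$ for every $i$. Then there exist unique points $G_1,\dots,G_N$ such that for all $1\le i\le N$: * $G_i\in[P_i,P_{i+1}]$ (the counterclockwise closed arc of $\mathbb S$), * $G_{\sigma(i)}=T_iG_{i-2}$ if $A_i=P_i$, * $G_{\sigma(i)}=T_{\tau(i)+1}G_{\tau(i)}$ if $A_i=Q_i$. -/

import Mathlib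

namespace BowenSeries

open scoped ComplexConjugate

/-- The closed unit disk: the hyperbolic plane `‖z‖ < 1` with its circle at infinity `‖z‖ = 1`. -/
abbrev ClosedDisk : Type := Metric.closedBall (0 : ℂ) 1

/-- An orientation preserving isometry of the hyperbolic disk, extended to the circle at
infinity: a Möbius transformation `z ↦ (a z + b) / (b̄ z + ā)` with `|b| < |a|`. -/
def IsMobius (T : Equiv.Perm ClosedDisk) : Prop :=
  ∃ a b : ℂ, ‖b‖ < ‖a‖ ∧
    ∀ z : ClosedDisk, (T z : ℂ) = (a * (z : ℂ) + b) / (conj b * (z : ℂ) + conj a)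

/-- The counterclockwise closed arc `[u, w]` of the circle at infinity. -/
def arc (u w : ClosedDisk) : Set ClosedDisk :=
  {x | ∃ s θ t : ℝ, s ≤ θ ∧ θ ≤ t ∧ t < s + 2 * Real.pi ∧
    (u : ℂ) = Complex.exp (s * Complex.I) ∧ (x : ℂ) = Complex.exp (θ * Complex.I) ∧
    (w : ℂ) = Complex.exp (t * Complex.I)}

/-- The hyperbolic geodesic with endpoints `u ≠ w` at infinity: the points of the open disk on
a circle through `u` and `w` orthogonal to the unit circle (centre `c`, squared radius
`‖c‖ ^ 2 - 1`), or on the diameter when `w = -u`. -/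
def geodesic (u w : ClosedDisk) : Set ClosedDisk :=
  {z | ‖(z : ℂ)‖ < 1 ∧
    ((∃ c : ℂ, ‖(u : ℂ) - c‖ ^ 2 = ‖c‖ ^ 2 - 1 ∧ ‖(w : ℂ) - c‖ ^ 2 = ‖c‖ ^ 2 - 1 ∧
        ‖(z : ℂ) - c‖ ^ 2 = ‖c‖ ^ 2 - 1) ∨
      ((w : ℂ) = -(u : ℂ) ∧ ∃ t : ℝ, (z : ℂ) = t * (u : ℂ)))}

/-- A real function whose zero set in the open disk is the geodesic from `u` to `w` (see
`mem_geodesic_iff`), positive on the open half-plane to the left of it. -/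
noncomputable def side (u w z : ℂ) : ℝ :=
  2 * (conj (w - u) * z).im - (1 + ‖z‖ ^ 2) * (conj w * u).im

theorem mem_geodesic_iff {u w z : ClosedDisk} (hu : ‖(u : ℂ)‖ = 1) (hw : ‖(w : ℂ)‖ = 1)
    (huw : u ≠ w) : z ∈ geodesic u w ↔ ‖(z : ℂ)‖ < 1 ∧ side u w z = 0 := by
  have huw' : (u : ℂ) ≠ w := fun h => huw (Subtype.ext h)
  have key : ∀ v : ℂ, ‖v‖ ^ 2 = v.re * v.re + v.im * v.im := fun v => by
    rw [← Complex.normSq_eq_norm_sq, Complex.normSq_apply]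
  have hu2 := key u
  have hw2 := key w
  rw [hu] at hu2
  rw [hw] at hw2
  refine and_congr_right fun _ => ?_
  generalize (u : ℂ) = u at *
  generalize (w : ℂ) = w at *
  generalize (z : ℂ) = z at *
  simp only [side, key]
  obtain ⟨a, b⟩ := u
  obtain ⟨c, d⟩ := w
  obtain ⟨x, y⟩ := z
  simp only [Complex.mul_im, Complex.conj_re, Complex.conj_im, Complex.sub_re,
    Complex.sub_im, Complex.ext_iff, Complex.neg_re, Complex.neg_im, Complex.mul_re,
    Complex.ofReal_re, Complex.ofReal_im, ne_eq] at *
  constructor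
  · rintro (⟨⟨p, q⟩, h1, h2, h3⟩ | ⟨⟨h1, h2⟩, t, h3, h4⟩)
    · have e1 : a * p + b * q = 1 := by simp only at h1; linarith
      have e2 : c * p + d * q = 1 := by simp only at h2; linarith
      have e3 : 2 * (x * p + y * q) = 1 + (x * x + y * y) := by simp only at h3; linarith
      rw [← e3]
      linear_combination (-2 * (c * y - d * x)) * e1 + (2 * (a * y - b * x)) * e2
    · rw [h1, h2, h3, h4]
      ring
  · intro h
    by_cases hm : c * b - d * a = 0
    · right
      have hs : (a * c + b * d - 1) * (a * c + b * d + 1) = 0 := by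
        linear_combination -(c * b - d * a) * hm - (c * c + d * d) * hu2 - hw2
      have hc : c = (a * c + b * d) * a := by linear_combination b * hm + c * hu2
      have hd : d = (a * c + b * d) * b := by linear_combination -a * hm + d * hu2
      rcases mul_eq_zero.mp hs with h1 | h1
      · exact absurd ⟨by rw [hc]; linear_combination -a * h1,
          by rw [hd]; linear_combination -b * h1⟩ huw'
      · have hc' : c = -a := by linear_combination hc + a * h1
        have hd' : d = -b := by linear_combination hd + b * h1
        subst hc' hd'
        refine ⟨⟨rfl, rfl⟩, a * x + b * y, ?_, ?_⟩
        · linear_combination x * hu2 + b / 4 * h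
        · linear_combination y * hu2 - a / 4 * h
    · left
      obtain ⟨m, hm'⟩ : ∃ m, m = c * b - d * a := ⟨_, rfl⟩
      rw [← hm'] at hm
      refine ⟨⟨(b - d) / m, (c - a) / m⟩, ?_, ?_, ?_⟩
      · have e : a * ((b - d) / m) + b * ((c - a) / m) = 1 := by
          field_simp
          linear_combination -hm'
        simp only
        linear_combination -2 * e - hu2
      · have e : c * ((b - d) / m) + d * ((c - a) / m) = 1 := by
          field_simp
          linear_combination -hm'
        simp only
        linear_combination -2 * e - hw2
      · have e : 2 * (x * ((b - d) / m) + y * ((c - a) / m)) = 1 + (x * x + y * y) := by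
          field_simp
          linear_combination h - (1 + (x * x + y * y)) * hm'
        simp only
        linear_combination -e

/-- The indices `1, …, 8g - 4` of the sides and vertices, taken mod `8g - 4`. -/
abbrev Idx (g : ℕ) : Type := ZMod (8 * g - 4)

/-- The side pairing `σ` (parity makes sense because `8g - 4` is even). -/
def sigma {g : ℕ} (i : Idx g) : Idx g :=
  if Odd i.val then 4 * (g : Idx g) - i else 2 - i

/-- `ρ(i) = σ(i) + 1`. -/
def rho {g : ℕ} (i : Idx g) : Idx g := sigma i + 1

/-- `τ(i) = i + (4g - 2)`. -/
def tau {g : ℕ} (i : Idx g) : Idx g := i + (4 * (g : Idx g) - 2)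

/-- The points are in the counterclockwise order `P₁, Q₁, P₂, Q₂, …, P_N, Q_N` on the unit
circle: `a` and `b` are their angles, continued periodically over all integers. -/
def InCyclicOrder {N : ℕ} (P Q : ZMod N → ClosedDisk) : Prop :=
  ∃ a b : ℤ → ℝ, ∀ k : ℤ,
    (P (k : ZMod N) : ℂ) = Complex.exp (a k * Complex.I) ∧
    (Q (k : ZMod N) : ℂ) = Complex.exp (b k * Complex.I) ∧
    a k < b k ∧ b k < a (k + 1) ∧
    a (k + (N : ℤ)) = a k + 2 * Real.pi ∧ b (k + (N : ℤ)) = b k + 2 * Real.pi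

/-- The region of the open disk to the left of all geodesics from `P i` to `Q (i + 1)`. -/
def region {N : ℕ} (P Q : ZMod N → ClosedDisk) : Set ClosedDisk :=
  {z | ‖(z : ℂ)‖ < 1 ∧ ∀ i, 0 ≤ side (P i) (Q (i + 1)) z}

/-- The `(8g - 4)`-sided fundamental polygon `F = region P Q` of a surface group of genus `g`,
with vertices `V i`, side pairing transformations `T i` and the endpoints `P i`, `Q (i + 1)` of
the geodesic extending side `i`. The group is generated by the `T i`; it is discrete and
cocompact because it has the compact fundamental domain `F`. -/
structure SurfacePolygon (g : ℕ) where
  V : Idx g → ClosedDisk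
  P : Idx g → ClosedDisk
  Q : Idx g → ClosedDisk
  T : Idx g → Equiv.Perm ClosedDisk
  /-- Vertices are points of the hyperbolic plane. -/
  norm_V : ∀ i, ‖(V i : ℂ)‖ < 1
  /-- The geodesic from `P i` to `Q (i + 1)` extends side `i`, which goes from `V i` to
  `V (i + 1)`. -/
  V_mem : ∀ i, V i ∈ geodesic (P i) (Q (i + 1))
  V_succ_mem : ∀ i, V (i + 1) ∈ geodesic (P i) (Q (i + 1))
  /-- Along that geodesic, `V i` comes before `V (i + 1)`. -/
  V_before : ∀ i, dist (P i) (V i) < dist (P i) (V (i + 1))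
  /-- The order of the endpoints at infinity. -/
  order : InCyclicOrder P Q
  /-- The `T i` are Möbius transformations pairing the sides. -/
  mobius : ∀ i, IsMobius (T i)
  T_V : ∀ i, T i (V i) = V (rho i)
  T_sigma : ∀ i, T (sigma i) * T i = 1
  T_cycle : ∀ i, T (rho (rho (rho i))) * T (rho (rho i)) * T (rho i) * T i = 1
  /-- The group acts freely on the hyperbolic plane. -/
  free : ∀ γ ∈ Subgroup.closure (Set.range T), ∀ z : ClosedDisk, ‖(z : ℂ)‖ < 1 →
    γ z = z → γ = 1
  /-- `F` is a fundamental domain: its translates cover the hyperbolic plane and have disjoint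
  interiors. -/
  covers : ∀ z : ClosedDisk, ‖(z : ℂ)‖ < 1 →
    ∃ γ ∈ Subgroup.closure (Set.range T), z ∈ γ '' region P Q
  interiors_disjoint : ∀ γ ∈ Subgroup.closure (Set.range T), γ ≠ 1 →
    Disjoint (γ '' interior (region P Q)) (interior (region P Q))
  /-- The extension condition: the geodesic extensions of the sides never intersect the
  interiors of the translates of `F`. -/
  extension : ∀ i, ∀ γ ∈ Subgroup.closure (Set.range T),
    Disjoint (geodesic (P i) (Q (i + 1))) (γ '' interior (region P Q))

/-- The parameters `A` are extremal: each `A i` is `P i` or `Q i`. -/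
def SurfacePolygon.IsExtremal {g : ℕ} (F : SurfacePolygon g) (A : Idx g → ClosedDisk) : Prop :=
  ∀ i, A i = F.P i ∨ A i = F.Q i

end BowenSeries

namespace BowenSeries

open scoped ComplexConjugate

/-! There are two ingredients: the action of the `T i` on the endpoints at infinity, and a
contraction argument on arcs.

Geometry. Move each vertex to the centre of the disk by `frame`. Geodesics through it become
diameters, and `T i` becomes a rotation from the frame at `V i` to the frame at `V (rho i)`. Write
`e j` for the unit number whose argument is the interior angle at `V j`. The relation `T_cycle` says
that the four `e j` along a `rho`-cycle have product 1. The extension condition forbids two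
consecutive angles of the cycle from adding up to more than π, so each consecutive pair adds up to
exactly π (`angle_mul_angle_rho`). Hence the two geodesics through `V i` are carried onto the two
through `V (rho i)`, which gives the images of their ends: `T_P`, `T_P_pred`, `T_Q`, `T_Q_add_two`.

Dynamics. Substituting `i = sigma k` turns the conditions into one equation `G k = T k (G (f k))`
for every `k`. Each map sends the arc `[P, P]` of index `f k` into that of index `k`, with one
endpoint going exactly to an endpoint (`liftsArc_sub_two`, `liftsArc_sub_one`). In terms of angles
the system is a monotone self-map of a product of compact intervals, so Knaster–Tarski gives a
solution. For uniqueness each arc is enlarged to `[Q (k - 1), Q (k + 1)]`, which contains it in its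
interior and is also mapped into its counterpart, strictly at the left end. The logarithm of the
cross ratio with the ends of the larger arc is a Hilbert metric that these maps strictly contract; a
pair of solutions at maximal distance contradicts this (`le_of_fixed`). -/

/-! ### Möbius transformations of the closed disk -/

/-- The Möbius transformation `z ↦ (a z + b) / (b̄ z + ā)`. -/
noncomputable def mob (a b z : ℂ) : ℂ := (a * z + b) / (conj b * z + conj a)

theorem mob_den_ne_zero {a b z : ℂ} (h : ‖b‖ < ‖a‖) (hz : ‖z‖ ≤ 1) :
    conj b * z + conj a ≠ 0 := by
  intro h0
  have h1 : ‖conj a‖ = ‖conj b * z‖ := by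
    rw [eq_neg_of_add_eq_zero_left h0, norm_neg]
  rw [norm_mul, RCLike.norm_conj, RCLike.norm_conj] at h1
  nlinarith [norm_nonneg b, norm_nonneg z]

theorem conj_mul_self_of_norm_eq_one {u : ℂ} (hu : ‖u‖ = 1) : conj u * u = 1 := by
  rw [mul_comm, Complex.mul_conj, Complex.normSq_eq_norm_sq, hu]
  norm_num

theorem mul_conj_self_of_norm_eq_one {u : ℂ} (hu : ‖u‖ = 1) : u * conj u = 1 := by
  rw [mul_comm, conj_mul_self_of_norm_eq_one hu]

theorem mob_mul_den {a b z : ℂ} (h : ‖b‖ < ‖a‖) (hz : ‖z‖ ≤ 1) :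
    mob a b z * (conj b * z + conj a) = a * z + b :=
  div_mul_cancel₀ _ (mob_den_ne_zero h hz)

theorem mob_sub {a b z w : ℂ} (h : ‖b‖ < ‖a‖) (hz : ‖z‖ ≤ 1) (hw : ‖w‖ ≤ 1) :
    (mob a b z - mob a b w) * ((conj b * z + conj a) * (conj b * w + conj a)) =
      (a * conj a - b * conj b) * (z - w) := by
  have ez := mob_mul_den h hz
  have ew := mob_mul_den h hw
  linear_combination (conj b * w + conj a) * ez - (conj b * z + conj a) * ew

theorem one_sub_conj_mob_mul {a b z w : ℂ} (h : ‖b‖ < ‖a‖) (hz : ‖z‖ ≤ 1) (hw : ‖w‖ ≤ 1) :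
    (1 - conj (mob a b z) * mob a b w) * (conj (conj b * z + conj a) * (conj b * w + conj a)) =
      (a * conj a - b * conj b) * (1 - conj z * w) := by
  have ez := congrArg conj (mob_mul_den h hz)
  have ew := mob_mul_den h hw
  simp only [map_add, map_mul, Complex.conj_conj] at *
  linear_combination -(mob a b w * (conj b * w + conj a)) * ez - (conj a * conj z + conj b) * ew

theorem mob_unit {a b u : ℂ} (h : ‖b‖ < ‖a‖) (hu : ‖u‖ = 1) :
    mob a b u * (conj b * u + conj a) = u * conj (conj b * u + conj a) := by
  have := mob_den_ne_zero h hu.le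
  unfold mob
  rw [div_mul_cancel₀ _ this]
  simp only [map_add, map_mul, Complex.conj_conj]
  linear_combination -b * mul_conj_self_of_norm_eq_one hu

theorem norm_mob_of_norm_eq_one {a b u : ℂ} (h : ‖b‖ < ‖a‖) (hu : ‖u‖ = 1) :
    ‖mob a b u‖ = 1 := by
  have h1 := congrArg norm (mob_unit h hu)
  rw [norm_mul, norm_mul, RCLike.norm_conj, hu] at h1
  exact mul_right_cancel₀ (norm_ne_zero_iff.mpr (mob_den_ne_zero h hu.le)) h1

theorem normSq_det_pos {a b : ℂ} (h : ‖b‖ < ‖a‖) : 0 < Complex.normSq a - Complex.normSq b := by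
  rw [Complex.normSq_eq_norm_sq, Complex.normSq_eq_norm_sq]
  nlinarith [norm_nonneg b]

theorem norm_mob_lt_one {a b z : ℂ} (h : ‖b‖ < ‖a‖) (hz : ‖z‖ < 1) : ‖mob a b z‖ < 1 := by
  have h1 := one_sub_conj_mob_mul h hz.le hz.le
  have hd := Complex.normSq_pos.mpr (mob_den_ne_zero h hz.le)
  have e : (1 - Complex.normSq (mob a b z)) * Complex.normSq (conj b * z + conj a) =
      (Complex.normSq a - Complex.normSq b) * (1 - Complex.normSq z) := by
    have : ∀ x : ℂ, conj x * x = (Complex.normSq x : ℂ) := fun x => by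
      rw [mul_comm, Complex.mul_conj]
    rw [this, this, this, Complex.mul_conj, Complex.mul_conj] at h1
    exact_mod_cast h1
  have h2 := normSq_det_pos h
  have h3 : 0 < 1 - Complex.normSq z := by
    rw [Complex.normSq_eq_norm_sq]; nlinarith [norm_nonneg z]
  have h4 : 0 < 1 - Complex.normSq (mob a b z) :=
    pos_of_mul_pos_left (e ▸ mul_pos h2 h3) hd.le
  rw [Complex.normSq_eq_norm_sq] at h4
  nlinarith [norm_nonneg (mob a b z)]

/-! ### Half-planes under Möbius transformations -/

/-- The right-hand side uses only expressions `x - y` and `1 - conj x * y`, which `mob_sub` and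
`one_sub_conj_mob_mul` transform by explicit factors. -/
theorem two_I_mul_side {u w : ℂ} (z : ℂ) (hu : ‖u‖ = 1) (hw : ‖w‖ = 1) :
    2 * Complex.I * u * w * (side u w z : ℂ) =
      (u - w) * ((z - u) * (1 - conj z * w) + (z - w) * (1 - conj z * u)) := by
  have him : ∀ x : ℂ, 2 * Complex.I * (x.im : ℂ) = x - conj x := fun x => by
    rw [Complex.sub_conj]; push_cast; ring
  have e : 2 * Complex.I * (side u w z : ℂ) = 2 * (conj (w - u) * z - conj (conj (w - u) * z))
      - (1 + z * conj z) * (conj w * u - conj (conj w * u)) := by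
    rw [← him, ← him, Complex.mul_conj, Complex.normSq_eq_norm_sq, side]
    push_cast
    ring
  have h1 := mul_conj_self_of_norm_eq_one hu
  have h2 := mul_conj_self_of_norm_eq_one hw
  calc _ = u * w * (2 * Complex.I * (side u w z : ℂ)) := by ring
    _ = _ := by
      rw [e]
      simp only [map_sub, map_mul, Complex.conj_conj]
      linear_combination (-2 * w * z - (1 + z * conj z) * -(w ^ 2)) * h1 +
        (2 * u * z - (1 + z * conj z) * u ^ 2) * h2

/-- Möbius transformations carry left half-planes to left half-planes; only the sign of the constant
matters later. -/
theorem side_mob {a b u w z : ℂ} (h : ‖b‖ < ‖a‖) (hu : ‖u‖ = 1) (hw : ‖w‖ = 1) (hz : ‖z‖ ≤ 1) :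
    ∃ c : ℝ, 0 < c ∧ side (mob a b u) (mob a b w) (mob a b z) = c * side u w z := by
  have e0 := two_I_mul_side z hu hw
  have e1 := two_I_mul_side (mob a b z) (norm_mob_of_norm_eq_one h hu)
    (norm_mob_of_norm_eq_one h hw)
  have s1 := mob_sub h hu.le hw.le
  have s2 := mob_sub h hz hu.le
  have s3 := mob_sub h hz hw.le
  have s4 := one_sub_conj_mob_mul h hz hu.le
  have s5 := one_sub_conj_mob_mul h hz hw.le
  have t1 := mob_unit h hu
  have t2 := mob_unit h hw
  have du := mob_den_ne_zero h hu.le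
  have dw := mob_den_ne_zero h hw.le
  have dz := mob_den_ne_zero h hz
  have hu0 : u ≠ 0 := fun h0 => by simp [h0] at hu
  have hw0 : w ≠ 0 := fun h0 => by simp [h0] at hw
  have nu := Complex.normSq_pos.mpr du
  have nw := Complex.normSq_pos.mpr dw
  have nz := Complex.normSq_pos.mpr dz
  have hΔ := normSq_det_pos h
  -- Each summand in `two_I_mul_side` is a product of three differences, and each difference
  -- contributes one determinant.
  refine ⟨(Complex.normSq a - Complex.normSq b) ^ 3 /
    (Complex.normSq (conj b * u + conj a) * Complex.normSq (conj b * w + conj a) *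
      Complex.normSq (conj b * z + conj a)), by positivity, ?_⟩
  rw [div_mul_eq_mul_div, eq_div_iff (by positivity)]
  have hI : (2 * Complex.I * u * w : ℂ) ≠ 0 :=
    mul_ne_zero (mul_ne_zero (by simp) hu0) hw0
  apply Complex.ofReal_injective
  apply mul_left_cancel₀ hI
  push_cast
  rw [← Complex.mul_conj, ← Complex.mul_conj, ← Complex.mul_conj, ← Complex.mul_conj,
    ← Complex.mul_conj]
  generalize conj b * u + conj a = x at *
  generalize conj b * w + conj a = y at *
  generalize conj b * z + conj a = v at *
  generalize mob a b u = U at *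
  generalize mob a b w = W at *
  generalize mob a b z = Z at *
  generalize a * conj a - b * conj b = Δ at *
  generalize (side u w z : ℂ) = S at *
  generalize (side U W Z : ℂ) = S' at *
  apply mul_right_cancel₀ (mul_ne_zero du dw)
  calc 2 * Complex.I * u * w * (S' * (x * conj x * (y * conj y) * (v * conj v))) * (x * y)
      = (2 * Complex.I * S') * (u * conj x) * (w * conj y) * (x * y) * (x * y) * (v * conj v) := by
        ring
    _ = (2 * Complex.I * S') * (U * x) * (W * y) * (x * y) * (x * y) * (v * conj v) := by
        rw [t1, t2]
    _ = (2 * Complex.I * U * W * S') * (x * y) ^ 3 * (v * conj v) := by ring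
    _ = ((U - W) * (x * y)) * (((Z - U) * (v * x)) * ((1 - conj Z * W) * (conj v * y)) +
          ((Z - W) * (v * y)) * ((1 - conj Z * U) * (conj v * x))) * (x * y) := by rw [e1]; ring
    _ = Δ ^ 3 * ((u - w) * ((z - u) * (1 - conj z * w) + (z - w) * (1 - conj z * u)))
          * (x * y) := by rw [s1, s2, s3, s4, s5]; ring
    _ = _ := by rw [← e0]; ring

/-! ### Frames at points of the open disk -/

/-- The isometry moving `V` to the centre of the disk. -/
noncomputable def frame (V z : ℂ) : ℂ := mob 1 (-V) z

theorem frame_coeff {V : ℂ} (hV : ‖V‖ < 1) : ‖-V‖ < ‖(1 : ℂ)‖ := by simpa using hV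

theorem frame_eq (V z : ℂ) : frame V z = (z - V) / (1 - conj V * z) := by
  simp only [frame, mob, map_neg, map_one]
  congr 1 <;> ring

theorem frame_den_ne_zero {V z : ℂ} (hV : ‖V‖ < 1) (hz : ‖z‖ ≤ 1) : 1 - conj V * z ≠ 0 := by
  have := mob_den_ne_zero (frame_coeff hV) hz
  simp only [map_neg, map_one] at this
  convert this using 1
  ring

theorem frame_mob {V ζ : ℂ} (hV : ‖V‖ < 1) (hζ : ‖ζ‖ ≤ 1) : frame V (mob 1 V ζ) = ζ := by
  have h0 : ‖V‖ < ‖(1 : ℂ)‖ := by simpa using hV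
  have h1 := mob_den_ne_zero h0 hζ
  have h2 : 1 - conj V * V ≠ 0 := frame_den_ne_zero hV hV.le
  rw [frame_eq]
  unfold mob
  simp only [map_one] at *
  have h3 : 1 - conj V * ((1 * ζ + V) / (conj V * ζ + 1)) =
      (1 - conj V * V) / (conj V * ζ + 1) := by field_simp; ring
  have h4 := div_mul_cancel₀ (1 * ζ + V) h1
  rw [h3, div_eq_iff (div_ne_zero h2 h1), mul_div_assoc', eq_div_iff h1]
  linear_combination h4

theorem mob_frame {V z : ℂ} (hV : ‖V‖ < 1) (hz : ‖z‖ ≤ 1) : mob 1 V (frame V z) = z := by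
  have h1 := frame_den_ne_zero hV hz
  have h2 : 1 - conj V * V ≠ 0 := frame_den_ne_zero hV hV.le
  rw [frame_eq]
  unfold mob
  simp only [map_one]
  have h3 : conj V * ((z - V) / (1 - conj V * z)) + 1 =
      (1 - conj V * V) / (1 - conj V * z) := by field_simp; ring
  have h4 := div_mul_cancel₀ (z - V) h1
  rw [h3, div_eq_iff (div_ne_zero h2 h1), ← mul_div_assoc z, eq_div_iff h1]
  linear_combination h4

theorem frame_injOn {V z w : ℂ} (hV : ‖V‖ < 1) (hz : ‖z‖ ≤ 1) (hw : ‖w‖ ≤ 1)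
    (h : frame V z = frame V w) : z = w := by
  rw [← mob_frame hV hz, h, mob_frame hV hw]

theorem norm_frame_eq_one {V u : ℂ} (hV : ‖V‖ < 1) (hu : ‖u‖ = 1) : ‖frame V u‖ = 1 :=
  norm_mob_of_norm_eq_one (frame_coeff hV) hu

/-- In the frames at `V` and at its image, a Möbius transformation is a rotation. -/
theorem exists_frame_mob {a b V : ℂ} (h : ‖b‖ < ‖a‖) (hV : ‖V‖ < 1) :
    ∃ r : ℂ, ‖r‖ = 1 ∧ ∀ z : ℂ, ‖z‖ ≤ 1 → frame (mob a b V) (mob a b z) = r * frame V z := by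
  have dV := mob_den_ne_zero h hV.le
  have dV' : conj (conj b * V + conj a) ≠ 0 := (map_ne_zero (starRingEnd ℂ)).mpr dV
  refine ⟨conj (conj b * V + conj a) / (conj b * V + conj a), ?_, fun z hz => ?_⟩
  · rw [norm_div, RCLike.norm_conj, div_self (norm_ne_zero_iff.mpr dV)]
  have dz := mob_den_ne_zero h hz
  have f1 := frame_den_ne_zero hV hz
  have s1 := mob_sub h hz hV.le
  have s2 := one_sub_conj_mob_mul h hV.le hz
  have hΔ : a * conj a - b * conj b ≠ 0 := by
    rw [Complex.mul_conj, Complex.mul_conj]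
    exact_mod_cast (normSq_det_pos h).ne'
  have f2 : 1 - conj (mob a b V) * mob a b z ≠ 0 := fun h0 => by
    rw [h0, zero_mul] at s2
    exact mul_ne_zero hΔ f1 s2.symm
  rw [frame_eq, frame_eq, div_mul_div_comm, div_eq_div_iff f2 (mul_ne_zero dV f1)]
  apply mul_right_cancel₀ (mul_ne_zero hΔ dz)
  linear_combination (a * conj a - b * conj b) * (1 - conj V * z) * s1 -
    (a * conj a - b * conj b) * (z - V) * s2

/-- The two ends of a geodesic through `V` are antipodal in the frame at `V`. -/
theorem frame_antipodal {u w V : ℂ} (hu : ‖u‖ = 1) (hw : ‖w‖ = 1) (huw : u ≠ w) (hV : ‖V‖ < 1)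
    (h : side u w V = 0) : frame V w = -frame V u := by
  have e := two_I_mul_side V hu hw
  rw [h, Complex.ofReal_zero, mul_zero] at e
  have e' := (mul_eq_zero.mp e.symm).resolve_left (sub_ne_zero.mpr huw)
  have f1 := frame_den_ne_zero hV hu.le
  have f2 := frame_den_ne_zero hV hw.le
  rw [frame_eq, frame_eq, ← neg_div, div_eq_div_iff f2 f1]
  linear_combination -e'

theorem side_frame {u w z V : ℂ} (hV : ‖V‖ < 1) (hu : ‖u‖ = 1) (hw : ‖w‖ = 1) (hz : ‖z‖ ≤ 1) :
    ∃ c : ℝ, 0 < c ∧ side (frame V u) (frame V w) (frame V z) = c * side u w z :=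
  side_mob (frame_coeff hV) hu hw hz

theorem side_neg (p ζ : ℂ) : side p (-p) ζ = -4 * (conj p * ζ).im := by
  simp only [side, map_sub, map_neg, Complex.mul_im, Complex.neg_re, Complex.neg_im,
    Complex.sub_re, Complex.sub_im, Complex.conj_re, Complex.conj_im]
  ring

/-! ### Arithmetic of `sigma`, `rho` and `tau` -/

section Indices

variable {g : ℕ}

theorem eight_mul_sub_four (hg : 2 ≤ g) : (8 * (g : Idx g) - 4) = 0 := by
  have h := ZMod.natCast_self (8 * g - 4)
  rw [Nat.cast_sub (by omega)] at h
  exact_mod_cast h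

theorem odd_val_intCast (hg : 2 ≤ g) (m : ℤ) : Odd ((m : Idx g).val) ↔ Odd m := by
  have : NeZero (8 * g - 4) := ⟨by omega⟩
  have h : (((m : Idx g).val : ℕ) : ℤ) = m % ((8 * g - 4 : ℕ) : ℤ) := ZMod.val_intCast m
  have h2 : ((8 * g - 4 : ℕ) : ℤ) = 2 * (4 * g - 2) := by omega
  rw [← Int.odd_coe_nat, h, h2, Int.odd_iff, Int.odd_iff, Int.emod_emod_of_dvd _ ⟨_, rfl⟩]

theorem sigma_intCast_of_odd (hg : 2 ≤ g) {m : ℤ} (hm : Odd m) :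
    sigma (m : Idx g) = ((4 * g - m : ℤ) : Idx g) := by
  rw [sigma, if_pos ((odd_val_intCast hg m).mpr hm)]
  push_cast
  rfl

theorem sigma_intCast_of_even (hg : 2 ≤ g) {m : ℤ} (hm : Even m) :
    sigma (m : Idx g) = ((2 - m : ℤ) : Idx g) := by
  rw [sigma, if_neg (by rw [odd_val_intCast hg]; exact Int.not_odd_iff_even.mpr hm)]
  push_cast
  rfl

theorem rho_intCast_of_odd (hg : 2 ≤ g) {m : ℤ} (hm : Odd m) :
    rho (m : Idx g) = ((4 * g - m + 1 : ℤ) : Idx g) := by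
  rw [rho, sigma_intCast_of_odd hg hm]
  push_cast
  rfl

theorem rho_intCast_of_even (hg : 2 ≤ g) {m : ℤ} (hm : Even m) :
    rho (m : Idx g) = ((2 - m + 1 : ℤ) : Idx g) := by
  rw [rho, sigma_intCast_of_even hg hm]
  push_cast
  rfl

theorem sigma_sigma (hg : 2 ≤ g) (i : Idx g) : sigma (sigma i) = i := by
  obtain ⟨m, rfl⟩ := ZMod.intCast_surjective i
  rcases Int.even_or_odd m with hm | hm
  · rw [sigma_intCast_of_even hg hm, sigma_intCast_of_even hg (by grind)]
    congr 1
    ring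
  · rw [sigma_intCast_of_odd hg hm, sigma_intCast_of_odd hg (by grind)]
    congr 1
    ring

theorem rho_sigma (hg : 2 ≤ g) (i : Idx g) : rho (sigma i) = i + 1 := by
  rw [rho, sigma_sigma hg]

theorem rho_rho_rho_rho (hg : 2 ≤ g) (i : Idx g) : rho (rho (rho (rho i))) = i := by
  obtain ⟨m, rfl⟩ := ZMod.intCast_surjective i
  have h := eight_mul_sub_four hg
  rcases Int.even_or_odd m with hm | hm
  · rw [rho_intCast_of_even hg hm, rho_intCast_of_odd hg (by grind),
      rho_intCast_of_even hg (by grind), rho_intCast_of_odd hg (by grind)]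
    push_cast
    linear_combination h
  · rw [rho_intCast_of_odd hg hm, rho_intCast_of_even hg (by grind),
      rho_intCast_of_odd hg (by grind), rho_intCast_of_even hg (by grind)]
    push_cast
    linear_combination -h

/-- Makes `rho (tau i + 1) = sigma i`, so that `T (tau i + 1)` sends `P (tau i)` to `P (sigma i)`.
-/
theorem sigma_tau_add_one (hg : 2 ≤ g) (i : Idx g) : sigma (tau i + 1) = sigma i - 1 := by
  obtain ⟨m, rfl⟩ := ZMod.intCast_surjective i
  have h := eight_mul_sub_four hg
  have e : tau (m : Idx g) + 1 = ((m + (4 * g - 2) + 1 : ℤ) : Idx g) := by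
    rw [tau]
    push_cast
    rfl
  rw [e]
  rcases Int.even_or_odd m with hm | hm
  · rw [sigma_intCast_of_even hg hm, sigma_intCast_of_odd hg (by grind)]
    push_cast
    ring
  · rw [sigma_intCast_of_odd hg hm, sigma_intCast_of_even hg (by grind)]
    push_cast
    linear_combination -h

end Indices

/-! ### Orientation on the circle and position along a geodesic -/

theorem side_exp (α β γ : ℝ) :
    side (Complex.exp (α * Complex.I)) (Complex.exp (β * Complex.I))
      (Complex.exp (γ * Complex.I)) =
    8 * Real.sin ((β - α) / 2) * Real.sin ((γ - β) / 2) * Real.sin ((γ - α) / 2) := by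
  obtain ⟨x, rfl⟩ : ∃ x, α = 2 * x := ⟨α / 2, by ring⟩
  obtain ⟨y, rfl⟩ : ∃ y, β = 2 * y := ⟨β / 2, by ring⟩
  obtain ⟨z, rfl⟩ : ∃ z, γ = 2 * z := ⟨γ / 2, by ring⟩
  have e : ∀ u v : ℝ, (2 * u - 2 * v) / 2 = u - v := fun u v => by ring
  have s1 : side (Complex.exp ((2 * x : ℝ) * Complex.I)) (Complex.exp ((2 * y : ℝ) * Complex.I))
      (Complex.exp ((2 * z : ℝ) * Complex.I)) = 2 * (Real.sin (2 * (z - y)) -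
        Real.sin (2 * (z - y) + 2 * (y - x)) + Real.sin (2 * (y - x))) := by
    have t1 : 2 * (z - y) = 2 * z - 2 * y := by ring
    have t2 : 2 * (z - y) + 2 * (y - x) = 2 * z - 2 * x := by ring
    have t3 : 2 * (y - x) = 2 * y - 2 * x := by ring
    rw [t2, t1, t3, Real.sin_sub, Real.sin_sub, Real.sin_sub]
    simp only [side, Complex.norm_exp_ofReal_mul_I, map_sub, Complex.mul_im, Complex.sub_re,
      Complex.sub_im, Complex.conj_re, Complex.conj_im, Complex.exp_ofReal_mul_I_re,
      Complex.exp_ofReal_mul_I_im]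
    ring
  rw [s1, e, e, e, show z - x = (z - y) + (y - x) by ring]
  generalize z - y = p
  generalize y - x = q
  have hp := Real.sin_sq_add_cos_sq p
  have hq := Real.sin_sq_add_cos_sq q
  rw [Real.sin_add (2 * p), Real.sin_add p, Real.sin_two_mul, Real.sin_two_mul, Real.cos_two_mul,
    Real.cos_two_mul]
  linear_combination (-8 * Real.sin q * Real.cos q) * hp + (-8 * Real.sin p * Real.cos p) * hq

theorem sin_half_pos {x : ℝ} (h0 : 0 < x) (h1 : x < 2 * Real.pi) : 0 < Real.sin (x / 2) :=
  Real.sin_pos_of_pos_of_lt_pi (by linarith) (by linarith)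

theorem side_exp_pos {α β γ : ℝ} (h1 : α < β) (h2 : β < γ) (h3 : γ < α + 2 * Real.pi) :
    0 < side (Complex.exp (α * Complex.I)) (Complex.exp (β * Complex.I))
      (Complex.exp (γ * Complex.I)) := by
  rw [side_exp]
  have := sin_half_pos (x := β - α) (by linarith) (by linarith)
  have := sin_half_pos (x := γ - β) (by linarith) (by linarith)
  have := sin_half_pos (x := γ - α) (by linarith) (by linarith)
  positivity

/-- Convexity of a half-plane: a geodesic with both ends in it stays in it. -/
theorem side_pos_of_side_eq_zero {p q u w V : ℂ} (hp : ‖p‖ = 1) (hq : ‖q‖ = 1) (hu : ‖u‖ = 1)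
    (hw : ‖w‖ = 1) (huw : u ≠ w) (hV : ‖V‖ < 1) (h : side u w V = 0) (h1 : 0 < side p q u)
    (h2 : 0 < side p q w) : 0 < side p q V := by
  obtain ⟨c1, hc1, e1⟩ := side_frame hV hp hq hu.le
  obtain ⟨c2, hc2, e2⟩ := side_frame hV hp hq hw.le
  obtain ⟨c3, hc3, e3⟩ := side_frame hV hp hq hV.le
  rw [frame_antipodal hu hw huw hV h] at e2
  have hn := norm_frame_eq_one hV hu
  have h0 : frame V V = 0 := by rw [frame_eq, sub_self, zero_div]
  rw [h0] at e3
  -- In the frame at `V` the ends are antipodal, so the terms linear in the third argument cancel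
  -- and the value at the centre remains.
  have key : side (frame V p) (frame V q) (frame V u) +
      side (frame V p) (frame V q) (-frame V u) = 4 * side (frame V p) (frame V q) 0 := by
    simp only [side, norm_neg, hn, mul_neg, Complex.neg_im, mul_zero, Complex.zero_im, norm_zero]
    ring
  have := mul_pos hc1 h1
  have := mul_pos hc2 h2
  exact pos_of_mul_pos_right (by linarith : 0 < c3 * side p q V) hc3.le

/-- If `V` and `z` lie on a geodesic with end `u`, then in the frame at `V` the point `z` is on
the diameter through the image of `u`. -/
theorem exists_frame_eq_mul {u w V z : ℂ} (hu : ‖u‖ = 1) (hw : ‖w‖ = 1) (huw : u ≠ w)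
    (hV : ‖V‖ < 1) (hz : ‖z‖ < 1) (hVs : side u w V = 0) (hzs : side u w z = 0) :
    ∃ s : ℝ, |s| < 1 ∧ frame V z = s * frame V u := by
  obtain ⟨c, -, e⟩ := side_frame hV hu hw hz.le
  rw [frame_antipodal hu hw huw hV hVs, hzs, mul_zero, side_neg] at e
  have hp := norm_frame_eq_one hV hu
  have hn : ‖frame V z‖ < 1 := norm_mob_lt_one (frame_coeff hV) hz
  have h1 : conj (frame V u) * frame V z = ((conj (frame V u) * frame V z).re : ℂ) := by
    apply Complex.ext
    · simp
    · rw [Complex.ofReal_im]; linarith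
  have h2 : frame V z = ((conj (frame V u) * frame V z).re : ℂ) * frame V u := by
    rw [← h1]
    linear_combination -frame V z * conj_mul_self_of_norm_eq_one hp
  refine ⟨_, ?_, h2⟩
  rw [h2, norm_mul, hp, mul_one, Complex.norm_real] at hn
  exact hn

/-- Relates Euclidean distance to the end `u`, in which `V_before` is expressed, to the signed
position `s` on the diameter in the frame. -/
theorem norm_sub_mul_norm {u V z : ℂ} {s : ℝ} (hu : ‖u‖ = 1) (hV : ‖V‖ < 1) (hz : ‖z‖ ≤ 1)
    (hs : |s| < 1) (h : frame V z = s * frame V u) :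
    ‖u - z‖ * ‖1 + s * (conj V * frame V u)‖ = ‖u - V‖ * |1 - s| := by
  have hp := norm_frame_eq_one hV hu
  have h0 : ‖V‖ < ‖(1 : ℂ)‖ := by simpa using hV
  have hsp : ‖(s : ℂ) * frame V u‖ ≤ 1 := by
    rw [norm_mul, hp, mul_one, Complex.norm_real]; exact hs.le
  have m1 := mob_sub h0 hp.le hsp
  have m2 := mob_sub h0 hp.le (z := frame V u) (w := 0) (by simp)
  have d := mob_den_ne_zero h0 hp.le
  rw [← h, mob_frame hV hu.le, mob_frame hV hz, h] at m1
  have e0 : mob 1 V 0 = V := by simp [mob]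
  rw [mob_frame hV hu.le, e0] at m2
  have e : (u - z) * (1 + s * (conj V * frame V u)) = (u - V) * ((1 - s : ℝ) : ℂ) := by
    apply mul_left_cancel₀ d
    simp only [map_one] at m1 m2 ⊢
    push_cast
    linear_combination m1 - (1 - s) * m2
  have := congrArg norm e
  rwa [norm_mul, norm_mul, Complex.norm_real] at this

theorem norm_conj_mul_frame_lt {u V : ℂ} (hu : ‖u‖ = 1) (hV : ‖V‖ < 1) :
    ‖conj V * frame V u‖ < 1 := by
  rw [norm_mul, RCLike.norm_conj, norm_frame_eq_one hV hu, mul_one]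
  exact hV

theorem neg_of_norm_sub_lt {u V z : ℂ} {s : ℝ} (hu : ‖u‖ = 1) (hV : ‖V‖ < 1) (hz : ‖z‖ ≤ 1)
    (hs : |s| < 1) (h : frame V z = s * frame V u) (hlt : ‖u - V‖ < ‖u - z‖) : s < 0 := by
  by_contra! h0
  have e := norm_sub_mul_norm hu hV hz hs h
  have hβ := norm_conj_mul_frame_lt hu hV
  generalize conj V * frame V u = β at *
  rw [abs_of_nonneg h0] at hs
  rw [abs_of_pos (by linarith)] at e
  have h1 : 1 - s ≤ ‖1 + s * β‖ := by
    have t := norm_sub_norm_le (1 : ℂ) (-(s * β))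
    rw [norm_neg, norm_mul, Complex.norm_real, Real.norm_of_nonneg h0, norm_one,
      sub_neg_eq_add] at t
    nlinarith
  nlinarith [norm_nonneg (u - V)]

theorem pos_of_norm_sub_lt {u V z : ℂ} {s : ℝ} (hu : ‖u‖ = 1) (hV : ‖V‖ < 1) (hz : ‖z‖ ≤ 1)
    (hs : |s| < 1) (h : frame V z = s * frame V u) (hlt : ‖u - z‖ < ‖u - V‖) : 0 < s := by
  by_contra! h0
  have e := norm_sub_mul_norm hu hV hz hs h
  have hβ := norm_conj_mul_frame_lt hu hV
  generalize conj V * frame V u = β at *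
  rw [abs_of_nonpos h0] at hs
  rw [abs_of_pos (by linarith)] at e
  have h1 : ‖1 + s * β‖ ≤ 1 - s := by
    have t := norm_add_le (1 : ℂ) (s * β)
    rw [norm_mul, Complex.norm_real, Real.norm_of_nonpos h0, norm_one] at t
    nlinarith
  nlinarith [norm_nonneg (u - z), norm_nonneg (1 + s * β)]

/-- Four rotations through angles in `(0, π)` with product the identity, such that the first two
and the last two do not exceed a half-turn together. -/
theorem mul_eq_neg_one_of_cycle {e₀ e₁ e₂ e₃ : ℂ} (n₀ : ‖e₀‖ = 1) (n₁ : ‖e₁‖ = 1)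
    (h₀ : 0 < e₀.im) (h₁ : 0 < e₁.im) (h₀₁ : 0 ≤ (e₀ * e₁).im) (h₂₃ : 0 ≤ (e₂ * e₃).im)
    (h : e₀ * e₁ * (e₂ * e₃) = 1) : e₀ * e₁ = -1 := by
  have hn : ‖e₀ * e₁‖ = 1 := by rw [norm_mul, n₀, n₁, one_mul]
  have hc : e₂ * e₃ = conj (e₀ * e₁) := by
    -- The second product is the inverse of the first, hence its conjugate; both imaginary parts
    -- being nonnegative, they vanish. The value 1 would give `e₁ = conj e₀`, which has negative
    -- imaginary part.
    linear_combination conj (e₀ * e₁) * h - (e₂ * e₃) * conj_mul_self_of_norm_eq_one hn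
  rw [hc, Complex.conj_im] at h₂₃
  have him : (e₀ * e₁).im = 0 := le_antisymm (by linarith) h₀₁
  have hre : (e₀ * e₁).re * (e₀ * e₁).re = 1 := by
    have := Complex.normSq_eq_norm_sq (e₀ * e₁)
    rw [Complex.normSq_apply, him, hn] at this
    linarith
  rcases mul_self_eq_one_iff.mp hre with h1 | h1
  · exfalso
    have h2 : e₀ * e₁ = 1 := Complex.ext h1 him
    have h3 : e₁ = conj e₀ := by
      linear_combination conj e₀ * h2 - e₁ * conj_mul_self_of_norm_eq_one n₀
    rw [h3, Complex.conj_im] at h₁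
    linarith
  · exact Complex.ext (by rw [h1]; simp) (by rw [him]; simp)

/-! ### Angles of the endpoints at infinity -/

/-- The point of the circle at infinity with angle `θ`. -/
noncomputable def circlePoint (θ : ℝ) : ClosedDisk :=
  ⟨Complex.exp (θ * Complex.I), by simp [Complex.norm_exp_ofReal_mul_I]⟩

theorem coe_circlePoint (θ : ℝ) : (circlePoint θ : ℂ) = Complex.exp (θ * Complex.I) := rfl

theorem norm_circlePoint (θ : ℝ) : ‖(circlePoint θ : ℂ)‖ = 1 :=
  Complex.norm_exp_ofReal_mul_I θ

theorem norm_coe_le_one (z : ClosedDisk) : ‖(z : ℂ)‖ ≤ 1 :=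
  mem_closedBall_zero_iff.mp z.2

/-- `a` and `b` are angles of the points `P` and `Q`, listed counterclockwise. -/
structure IsAngleLift {N : ℕ} (P Q : ZMod N → ClosedDisk) (a b : ℤ → ℝ) : Prop where
  P_eq : ∀ k : ℤ, P k = circlePoint (a k)
  Q_eq : ∀ k : ℤ, Q k = circlePoint (b k)
  lt : ∀ k, a k < b k
  lt_succ : ∀ k, b k < a (k + 1)
  a_add : ∀ k, a (k + N) = a k + 2 * Real.pi
  b_add : ∀ k, b (k + N) = b k + 2 * Real.pi

theorem InCyclicOrder.exists_isAngleLift {N : ℕ} {P Q : ZMod N → ClosedDisk}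
    (h : InCyclicOrder P Q) : ∃ a b, IsAngleLift P Q a b := by
  obtain ⟨a, b, h⟩ := h
  exact ⟨a, b, fun k => Subtype.ext (h k).1, fun k => Subtype.ext (h k).2.1,
    fun k => (h k).2.2.1, fun k => (h k).2.2.2.1, fun k => (h k).2.2.2.2.1,
    fun k => (h k).2.2.2.2.2⟩

namespace IsAngleLift

variable {N : ℕ} {P Q : ZMod N → ClosedDisk} {a b : ℤ → ℝ}

theorem strictMono_a (h : IsAngleLift P Q a b) : StrictMono a :=
  strictMono_int_of_lt_succ fun k => (h.lt k).trans (h.lt_succ k)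

theorem strictMono_b (h : IsAngleLift P Q a b) : StrictMono b :=
  strictMono_int_of_lt_succ fun k => (h.lt_succ k).trans (h.lt (k + 1))

theorem a_lt_b (h : IsAngleLift P Q a b) {k l : ℤ} (hkl : k ≤ l) : a k < b l :=
  (h.strictMono_a.monotone hkl).trans_lt (h.lt l)

theorem b_lt_a (h : IsAngleLift P Q a b) {k l : ℤ} (hkl : k < l) : b k < a l :=
  (h.lt_succ k).trans_le (h.strictMono_a.monotone hkl)

end IsAngleLift

theorem IsMobius.exists_mob {T : Equiv.Perm ClosedDisk} (h : IsMobius T) :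
    ∃ a b : ℂ, ‖b‖ < ‖a‖ ∧ ∀ z : ClosedDisk, (T z : ℂ) = mob a b z := h

/-! ### Position of the vertices relative to the sides -/

namespace SurfacePolygon

variable {g : ℕ} (F : SurfacePolygon g)

theorem norm_P (i : Idx g) : ‖(F.P i : ℂ)‖ = 1 := by
  obtain ⟨a, b, h⟩ := F.order.exists_isAngleLift
  obtain ⟨m, rfl⟩ := ZMod.intCast_surjective i
  rw [h.P_eq, norm_circlePoint]

theorem norm_Q (i : Idx g) : ‖(F.Q i : ℂ)‖ = 1 := by
  obtain ⟨a, b, h⟩ := F.order.exists_isAngleLift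
  obtain ⟨m, rfl⟩ := ZMod.intCast_surjective i
  rw [h.Q_eq, norm_circlePoint]

/-- Points at infinity outside the arc cut off by a side are to its left. -/
theorem side_pos_of_lt {a b : ℤ → ℝ} (h : IsAngleLift F.P F.Q a b) {j : ℤ} {θ : ℝ}
    (h1 : b (j + 1) < θ) (h2 : θ < a j + 2 * Real.pi) :
    0 < side (F.P (j : Idx g)) (F.Q ((j : Idx g) + 1)) (circlePoint θ) := by
  have e : ((j : Idx g) + 1) = ((j + 1 : ℤ) : Idx g) := by push_cast; rfl
  rw [e, h.P_eq, h.Q_eq]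
  exact side_exp_pos (h.a_lt_b (by omega)) h1 h2

theorem cast_size (hg : 2 ≤ g) : ((8 * g - 4 : ℕ) : ℤ) = 8 * g - 4 := by omega

theorem P_ne_Q_succ (hg : 2 ≤ g) (i : Idx g) : (F.P i : ℂ) ≠ F.Q (i + 1) := by
  obtain ⟨a, b, h⟩ := F.order.exists_isAngleLift
  obtain ⟨m, rfl⟩ := ZMod.intCast_surjective i
  have hN := cast_size hg
  have h1 := F.side_pos_of_lt h (j := m) (θ := a (m + 2)) (h.b_lt_a (by omega)) (by
    rw [← h.a_add]; exact h.strictMono_a (by omega))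
  intro h0
  rw [h0] at h1
  simp [side, Complex.mul_im] at h1
  linarith

theorem side_V (hg : 2 ≤ g) (i : Idx g) : side (F.P i) (F.Q (i + 1)) (F.V i) = 0 :=
  ((mem_geodesic_iff (F.norm_P i) (F.norm_Q _)
    fun h => F.P_ne_Q_succ hg i (congrArg _ h)).mp (F.V_mem i)).2

theorem side_V_succ (hg : 2 ≤ g) (i : Idx g) : side (F.P i) (F.Q (i + 1)) (F.V (i + 1)) = 0 :=
  ((mem_geodesic_iff (F.norm_P i) (F.norm_Q _)
    fun h => F.P_ne_Q_succ hg i (congrArg _ h)).mp (F.V_succ_mem i)).2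

theorem side_P_pred_pos (hg : 2 ≤ g) (i : Idx g) :
    0 < side (F.P i) (F.Q (i + 1)) (F.P (i - 1)) := by
  obtain ⟨a, b, h⟩ := F.order.exists_isAngleLift
  obtain ⟨m, rfl⟩ := ZMod.intCast_surjective i
  have hN := cast_size hg
  have e : ((m : Idx g) - 1) = ((m - 1 + (8 * g - 4 : ℕ) : ℤ) : Idx g) := by
    rw [Int.cast_add, Int.cast_natCast, ZMod.natCast_self]
    push_cast
    ring
  rw [e, h.P_eq (m - 1 + (8 * g - 4 : ℕ))]
  exact F.side_pos_of_lt h (h.b_lt_a (by omega)) (by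
    rw [← h.a_add]; exact h.strictMono_a (by omega))

/-- A vertex lies strictly to the left of all sides except the two that meet there. -/
theorem side_V_pos (hg : 2 ≤ g) {i j : Idx g} (h1 : j ≠ i) (h2 : j ≠ i - 1) :
    0 < side (F.P j) (F.Q (j + 1)) (F.V i) := by
  obtain ⟨a, b, h⟩ := F.order.exists_isAngleLift
  obtain ⟨m, rfl⟩ := ZMod.intCast_surjective j
  have hN := cast_size hg
  have : NeZero (8 * g - 4) := ⟨by omega⟩
  obtain ⟨d, hd0, hdN, rfl⟩ : ∃ d : ℤ, 0 ≤ d ∧ d < 8 * g - 4 ∧ i = ((m + d : ℤ) : Idx g) := by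
    refine ⟨((i - m : Idx g).val : ℤ), by positivity, ?_, ?_⟩
    · have := ZMod.val_lt (i - m : Idx g)
      omega
    · rw [Int.cast_add, Int.cast_natCast, ZMod.natCast_zmod_val]
      ring
  have d0 : d ≠ 0 := fun h0 => h1 (by rw [h0, add_zero])
  have d1 : d ≠ 1 := fun h0 => h2 (by rw [h0]; push_cast; ring)
  -- A side at cyclic distance at least 2 from side `m` has both ends to the left of it, hence so
  -- are the points of its geodesic.
  have key : ∀ l : ℤ, m + 2 ≤ l → l + 2 ≤ m + (8 * g - 4) →
      side (F.P (l : Idx g)) (F.Q ((l : Idx g) + 1)) (F.V (m + d : ℤ)) = 0 →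
      0 < side (F.P (m : Idx g)) (F.Q ((m : Idx g) + 1)) (F.V (m + d : ℤ)) := by
    intro l hl1 hl2 hs
    have e : ((l : Idx g) + 1) = ((l + 1 : ℤ) : Idx g) := by push_cast; rfl
    refine side_pos_of_side_eq_zero (F.norm_P _) (F.norm_Q _) (F.norm_P l) (F.norm_Q (l + 1))
      (F.P_ne_Q_succ hg _) (F.norm_V _) hs ?_ ?_
    · rw [h.P_eq l]
      exact F.side_pos_of_lt h (h.b_lt_a (by omega)) (by
        rw [← h.a_add]; exact h.strictMono_a (by omega))
    · rw [e, h.Q_eq]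
      exact F.side_pos_of_lt h (h.strictMono_b (by omega)) (by
        rw [← h.a_add]
        exact (h.lt_succ _).trans_le (h.strictMono_a.monotone (by omega)))
  -- Two sides meet at the vertex. Side `m + d` serves unless `d = 8g - 5`, when it is adjacent to
  -- side `m` and the preceding one is used.
  rcases lt_or_ge (d + 1) (8 * g - 4) with hd | hd
  · exact key (m + d) (by omega) (by omega) (F.side_V hg _)
  · refine key (m + d - 1) (by omega) (by omega) ?_
    have := F.side_V_succ hg ((m + d - 1 : ℤ) : Idx g)
    have e : (((m + d - 1 : ℤ) : Idx g) + 1) = ((m + d : ℤ) : Idx g) := by push_cast; ring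
    rwa [e] at this ⊢

/-! ### Interior angles, and side pairings as rotations -/

/-- The image of `P i` in the frame at `V i`. -/
noncomputable def dirP (i : Idx g) : ℂ := frame (F.V i) (F.P i)

/-- The image of `P (i - 1)` in the frame at `V i`. -/
noncomputable def dirPPred (i : Idx g) : ℂ := frame (F.V i) (F.P (i - 1))

theorem norm_dirP (i : Idx g) : ‖F.dirP i‖ = 1 := norm_frame_eq_one (F.norm_V i) (F.norm_P i)

theorem norm_dirPPred (i : Idx g) : ‖F.dirPPred i‖ = 1 :=
  norm_frame_eq_one (F.norm_V i) (F.norm_P _)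

theorem frame_Q_succ (hg : 2 ≤ g) (i : Idx g) : frame (F.V i) (F.Q (i + 1)) = -F.dirP i :=
  frame_antipodal (F.norm_P i) (F.norm_Q _) (F.P_ne_Q_succ hg i) (F.norm_V i) (F.side_V hg i)

theorem frame_Q (hg : 2 ≤ g) (i : Idx g) : frame (F.V i) (F.Q i) = -F.dirPPred i := by
  have h1 := F.P_ne_Q_succ hg (i - 1)
  have h2 := F.side_V_succ hg (i - 1)
  rw [sub_add_cancel] at h1 h2
  exact frame_antipodal (F.norm_P _) (F.norm_Q i) h1 (F.norm_V i) h2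

/-- In the frame, `-dirP i` points to `V (i + 1)` and `dirPPred i` to `V (i - 1)`. Their quotient,
the number here, has the interior angle as argument, which thus lies in `(0, π)`. -/
theorem im_angle_pos (hg : 2 ≤ g) (i : Idx g) : 0 < (-F.dirPPred i * conj (F.dirP i)).im := by
  obtain ⟨c, hc, e⟩ := side_frame (F.norm_V i) (F.norm_P i) (F.norm_Q (i + 1))
    (F.norm_P (i - 1)).le
  rw [F.frame_Q_succ hg, dirP, side_neg] at e
  have := mul_pos hc (F.side_P_pred_pos hg i)
  change -4 * (conj (F.dirP i) * F.dirPPred i).im = _ at e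
  rw [neg_mul, Complex.neg_im, mul_comm]
  linarith

theorem T_V_succ (hg : 2 ≤ g) (i : Idx g) : F.T i (F.V (i + 1)) = F.V (sigma i) := by
  have h := F.T_sigma (sigma i)
  rw [sigma_sigma hg] at h
  have h2 := F.T_V (sigma i)
  rw [rho_sigma hg] at h2
  rw [← h2, ← Equiv.Perm.mul_apply, h, Equiv.Perm.one_apply]

/-- In the frames at `V i` and its image `V (rho i)`, `T i` is a rotation. -/
theorem frame_T (hg : 2 ≤ g) (i : Idx g) (z : ClosedDisk) :
    frame (F.V (rho i)) (F.T i z) =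
      -F.dirPPred (rho i) * conj (F.dirP i) * frame (F.V i) z := by
  obtain ⟨a, b, hab, hT⟩ := (F.mobius i).exists_mob
  obtain ⟨r, hr, hrz⟩ := exists_frame_mob hab (F.norm_V i)
  rw [← hT, F.T_V] at hrz
  have hr' : ∀ z : ClosedDisk, frame (F.V (rho i)) (F.T i z) = r * frame (F.V i) z := fun z => by
    rw [hT]
    exact hrz z (norm_coe_le_one z)
  have hne := F.P_ne_Q_succ hg
  have hd : ∀ j, ‖(F.P j : ℂ) - F.V j‖ < ‖(F.P j : ℂ) - F.V (j + 1)‖ := fun j => by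
    have := F.V_before j
    rwa [Subtype.dist_eq, Subtype.dist_eq, dist_eq_norm, dist_eq_norm] at this
  obtain ⟨s, hs, hs'⟩ := exists_frame_eq_mul (F.norm_P i) (F.norm_Q _) (hne i) (F.norm_V i)
    (F.norm_V (i + 1)) (F.side_V hg i) (F.side_V_succ hg i)
  have s0 := neg_of_norm_sub_lt (F.norm_P i) (F.norm_V i) (F.norm_V (i + 1)).le hs hs' (hd i)
  obtain ⟨t, ht, ht'⟩ := exists_frame_eq_mul (F.norm_P (sigma i)) (F.norm_Q _) (hne (sigma i))
    (F.norm_V (sigma i + 1)) (F.norm_V (sigma i)) (F.side_V_succ hg _) (F.side_V hg _)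
  have t0 := pos_of_norm_sub_lt (F.norm_P _) (F.norm_V (sigma i + 1)) (F.norm_V (sigma i)).le ht
    ht' (hd (sigma i))
  have e := hr' (F.V (i + 1))
  have hq : frame (F.V (sigma i + 1)) (F.P (sigma i)) = F.dirPPred (rho i) := by
    rw [dirPPred, rho, add_sub_cancel_right]
  rw [F.T_V_succ hg, hs', show rho i = sigma i + 1 from rfl, ht', hq] at e
  change (t : ℂ) * _ = r * (s * F.dirP i) at e
  -- The rotation `r` is read off from the image `V (sigma i)` of `V (i + 1)`: moduli give `|t| =
  -- |s|`, and the order of the vertices on their sides gives `s < 0 < t`.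
  have hts : t = -s := by
    have := congrArg norm e
    rwa [norm_mul, norm_mul, norm_mul, norm_dirPPred, norm_dirP, hr, Complex.norm_real,
      Complex.norm_real, Real.norm_of_nonneg t0.le, Real.norm_of_nonpos s0.le, mul_one, one_mul,
      mul_one] at this
  have hs0 : (s : ℂ) ≠ 0 := by exact_mod_cast s0.ne
  have e2 : r * F.dirP i = -F.dirPPred (rho i) := by
    apply mul_left_cancel₀ hs0
    rw [hts] at e
    push_cast at e
    linear_combination -e
  rw [hr', ← e2, mul_assoc r, mul_conj_self_of_norm_eq_one (F.norm_dirP i), mul_one]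

theorem frame_injective (i : Idx g) {z w : ClosedDisk}
    (h : frame (F.V i) z = frame (F.V i) w) : z = w :=
  Subtype.ext (frame_injOn (F.norm_V i) (norm_coe_le_one z) (norm_coe_le_one w) h)

/-- The four rotations of `frame_T` along the cycle compose to the identity; regrouping their
factors by vertex gives the angles. -/
theorem angle_cycle (hg : 2 ≤ g) (i : Idx g) :
    (-F.dirPPred i * conj (F.dirP i)) * (-F.dirPPred (rho i) * conj (F.dirP (rho i))) *
      ((-F.dirPPred (rho (rho i)) * conj (F.dirP (rho (rho i)))) *
        (-F.dirPPred (rho (rho (rho i))) * conj (F.dirP (rho (rho (rho i)))))) = 1 := by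
  have h : F.T (rho (rho (rho i))) (F.T (rho (rho i)) (F.T (rho i) (F.T i (F.P i)))) = F.P i := by
    have := congrArg (fun f : Equiv.Perm ClosedDisk => f (F.P i)) (F.T_cycle i)
    simpa using this
  have e := congrArg (fun z : ClosedDisk => frame (F.V i) z) h
  have e1 := F.frame_T hg (rho (rho (rho i)))
    (F.T (rho (rho i)) (F.T (rho i) (F.T i (F.P i))))
  rw [rho_rho_rho_rho hg] at e1
  beta_reduce at e
  rw [e1, F.frame_T hg, F.frame_T hg, F.frame_T hg] at e
  change _ = F.dirP i at e
  change _ * (_ * (_ * (_ * F.dirP i))) = F.dirP i at e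
  have hp := mul_conj_self_of_norm_eq_one (F.norm_dirP i)
  linear_combination conj (F.dirP i) * e + (1 - F.dirPPred i * F.dirPPred (rho i) *
    F.dirPPred (rho (rho i)) * F.dirPPred (rho (rho (rho i))) * conj (F.dirP i) *
    conj (F.dirP (rho i)) * conj (F.dirP (rho (rho i))) *
    conj (F.dirP (rho (rho (rho i))))) * hp

end SurfacePolygon

/-! ### The extension condition makes consecutive angles supplementary -/

theorem continuous_side (u w : ℂ) : Continuous (side u w) := by
  unfold side
  fun_prop

theorem mem_interior_region {N : ℕ} [NeZero N] {P Q : ZMod N → ClosedDisk} {z : ClosedDisk}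
    (hz : ‖(z : ℂ)‖ < 1) (h : ∀ i, 0 < side (P i) (Q (i + 1)) z) : z ∈ interior (region P Q) := by
  refine mem_interior.mpr ⟨{z | ‖(z : ℂ)‖ < 1} ∩ ⋂ i, {z | 0 < side (P i) (Q (i + 1)) z}, ?_, ?_,
    hz, Set.mem_iInter.mpr h⟩
  · rintro x ⟨hx, hx'⟩
    exact ⟨hx, fun i => (Set.mem_iInter.mp hx' i).le⟩
  · exact (isOpen_lt (by fun_prop) continuous_const).inter (isOpen_iInter_of_finite fun i =>
      isOpen_lt continuous_const ((continuous_side _ _).comp continuous_subtype_val))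

theorem continuousAt_mob_mul (V d : ℂ) :
    ContinuousAt (fun ε : ℝ => mob 1 V (ε * d)) 0 := by
  unfold mob
  refine ContinuousAt.div (by fun_prop) (by fun_prop) ?_
  simp

namespace SurfacePolygon

variable {g : ℕ} (F : SurfacePolygon g)

open Filter Topology in
/-- Points close to `V i` in a direction strictly between the two sides are interior. -/
theorem eventually_side_pos (hg : 2 ≤ g) (i : Idx g) {d : ℂ} (hd : ‖d‖ = 1)
    (h1 : (conj (F.dirP i) * d).im < 0) (h2 : (conj (F.dirPPred i) * d).im < 0) :
    ∀ᶠ ε : ℝ in 𝓝[>] 0, ∀ j, 0 < side (F.P j) (F.Q (j + 1)) (mob 1 (F.V i) (ε * d)) := by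
  have : NeZero (8 * g - 4) := ⟨by omega⟩
  have hlt : ∀ᶠ ε : ℝ in 𝓝[>] 0, ε < 1 :=
    (eventually_lt_nhds one_pos).filter_mono nhdsWithin_le_nhds
  have hV1 : ‖(F.V i : ℂ)‖ < ‖(1 : ℂ)‖ := by simpa using F.norm_V i
  -- The two sides through `V i` are diameters in the frame, so positivity holds along the whole
  -- ray. The other sides are positive at `V i` itself and follow by continuity.
  have key : ∀ p : ℂ, (conj p * d).im < 0 → ∀ ε : ℝ, 0 < ε → ε < 1 → ∀ u w : ℂ, ‖u‖ = 1 →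
      ‖w‖ = 1 → frame (F.V i) u = p → frame (F.V i) w = -p →
      0 < side u w (mob 1 (F.V i) (ε * d)) := by
    intro p hp ε h0 h1 u w hu hw hup hwp
    have hn : ‖(ε : ℂ) * d‖ < 1 := by
      rwa [norm_mul, hd, mul_one, Complex.norm_real, Real.norm_of_nonneg h0.le]
    obtain ⟨c, hc, e⟩ := side_frame (F.norm_V i) hu hw (norm_mob_lt_one hV1 hn).le
    rw [hup, hwp, frame_mob (F.norm_V i) hn.le, side_neg, mul_left_comm,
      Complex.im_ofReal_mul] at e
    have := mul_neg_of_pos_of_neg h0 hp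
    exact pos_of_mul_pos_right (by linarith : 0 < c * side u w _) hc.le
  refine eventually_all.mpr fun j => ?_
  by_cases hj : j = i
  · subst hj
    filter_upwards [self_mem_nhdsWithin, hlt] with ε e0 e1
    exact key _ h1 ε e0 e1 _ _ (F.norm_P j) (F.norm_Q _) rfl (F.frame_Q_succ hg j)
  by_cases hj' : j = i - 1
  · subst hj'
    filter_upwards [self_mem_nhdsWithin, hlt] with ε e0 e1
    refine key _ h2 ε e0 e1 _ _ (F.norm_P _) (F.norm_Q _) rfl ?_
    rw [sub_add_cancel]
    exact F.frame_Q hg i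
  · have ht := ((continuous_side (F.P j) (F.Q (j + 1))).continuousAt.comp
      (continuousAt_mob_mul (F.V i) d)).tendsto
    have e0 : mob 1 (F.V i) ((0 : ℝ) * d) = F.V i := by simp [mob]
    simp only [Function.comp_def, e0] at ht
    exact (ht.eventually_const_lt (F.side_V_pos hg hj hj')).filter_mono nhdsWithin_le_nhds

/-- If the two angles added up to more than π, the geodesic of side `rho i`, continued backwards
past `V (rho i)`, would enter the interior of `T i F`, against the extension condition. -/
theorem im_angle_mul_nonneg (hg : 2 ≤ g) (i : Idx g) :
    0 ≤ ((-F.dirPPred i * conj (F.dirP i)) *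
      (-F.dirPPred (rho i) * conj (F.dirP (rho i)))).im := by
  by_contra! hneg
  have hpi := F.norm_dirP i
  have hpr := F.norm_dirP (rho i)
  have hqr := F.norm_dirPPred (rho i)
  -- The direction at `V i` that `T i` rotates to `dirP (rho i)`, the backward continuation of side
  -- `rho i`.
  obtain ⟨d, hd⟩ : ∃ d, d = -F.dirP (rho i) * conj (F.dirPPred (rho i)) * F.dirP i := ⟨_, rfl⟩
  have hdn : ‖d‖ = 1 := by
    rw [hd, norm_mul, norm_mul, norm_neg, RCLike.norm_conj, hpi, hpr, hqr]
    norm_num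
  have h1 : (conj (F.dirP i) * d).im < 0 := by
    have e : conj (F.dirP i) * d = conj (-F.dirPPred (rho i) * conj (F.dirP (rho i))) := by
      rw [hd]
      simp only [map_mul, map_neg, Complex.conj_conj]
      linear_combination -F.dirP (rho i) * conj (F.dirPPred (rho i)) *
        conj_mul_self_of_norm_eq_one hpi
    rw [e, Complex.conj_im]
    linarith [F.im_angle_pos hg (rho i)]
  have h2 : (conj (F.dirPPred i) * d).im < 0 := by
    have e : conj (F.dirPPred i) * d = -conj ((-F.dirPPred i * conj (F.dirP i)) *
      (-F.dirPPred (rho i) * conj (F.dirP (rho i)))) := by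
      rw [hd]
      simp only [map_mul, map_neg, Complex.conj_conj]
      ring
    rw [e, Complex.neg_im, Complex.conj_im, neg_neg]
    exact hneg
  have : NeZero (8 * g - 4) := ⟨by omega⟩
  obtain ⟨ε, hs, e1, e0⟩ := ((F.eventually_side_pos hg i hdn h1 h2).and
    (((eventually_lt_nhds one_pos).filter_mono nhdsWithin_le_nhds).and
      self_mem_nhdsWithin)).exists
  change 0 < ε at e0
  have hn : ‖(ε : ℂ) * d‖ < 1 := by
    rwa [norm_mul, hdn, mul_one, Complex.norm_real, Real.norm_of_nonneg e0.le]
  have hz : ‖mob 1 (F.V i) (ε * d)‖ < 1 :=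
    norm_mob_lt_one (by simpa using F.norm_V i) hn
  obtain ⟨z, hzz⟩ : ∃ z : ClosedDisk, (z : ℂ) = mob 1 (F.V i) (ε * d) :=
    ⟨⟨_, mem_closedBall_zero_iff.mpr hz.le⟩, rfl⟩
  rw [← hzz] at hz
  have hzi : z ∈ interior (region F.P F.Q) := mem_interior_region hz fun j => by
    rw [hzz]; exact hs j
  have hf := F.frame_T hg i z
  rw [hzz, frame_mob (F.norm_V i) hn.le] at hf
  have hf' : frame (F.V (rho i)) (F.T i z) = ε * F.dirP (rho i) := by
    rw [hf, hd]
    have t1 := conj_mul_self_of_norm_eq_one hpi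
    have t2 := conj_mul_self_of_norm_eq_one hqr
    linear_combination ε * F.dirP (rho i) * (t1 * (conj (F.dirPPred (rho i)) *
      F.dirPPred (rho i)) + t2)
  have hTz : ‖(F.T i z : ℂ)‖ < 1 := by
    obtain ⟨a, b, hab, hT⟩ := (F.mobius i).exists_mob
    rw [hT]
    exact norm_mob_lt_one hab hz
  refine Set.disjoint_left.mp (F.extension (rho i) (F.T i)
    (Subgroup.subset_closure ⟨i, rfl⟩)) ?_ ⟨z, hzi, rfl⟩
  rw [mem_geodesic_iff (F.norm_P _) (F.norm_Q _)
    fun h => F.P_ne_Q_succ hg (rho i) (congrArg _ h)]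
  refine ⟨hTz, ?_⟩
  obtain ⟨c, hc, e⟩ := side_frame (F.norm_V (rho i)) (F.norm_P (rho i)) (F.norm_Q (rho i + 1))
    hTz.le
  rw [hf', F.frame_Q_succ hg, ← dirP, side_neg, mul_left_comm,
    conj_mul_self_of_norm_eq_one hpr, mul_one, Complex.ofReal_im, mul_zero] at e
  exact (mul_eq_zero.mp e.symm).resolve_left hc.ne'

/-- The angles of the polygon at `V i` and `V (rho i)` are supplementary. -/
theorem angle_mul_angle_rho (hg : 2 ≤ g) (i : Idx g) :
    (-F.dirPPred i * conj (F.dirP i)) * (-F.dirPPred (rho i) * conj (F.dirP (rho i))) = -1 := by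
  have hn : ∀ j, ‖-F.dirPPred j * conj (F.dirP j)‖ = 1 := fun j => by
    rw [norm_mul, norm_neg, RCLike.norm_conj, norm_dirP, norm_dirPPred, one_mul]
  exact mul_eq_neg_one_of_cycle (hn _) (hn _) (F.im_angle_pos hg _) (F.im_angle_pos hg _)
    (F.im_angle_mul_nonneg hg i) (F.im_angle_mul_nonneg hg _) (F.angle_cycle hg i)

theorem dirP_rho (hg : 2 ≤ g) (i : Idx g) :
    F.dirP (rho i) = -F.dirPPred (rho i) * conj (F.dirP i) * F.dirPPred i := by
  have h := F.angle_mul_angle_rho hg i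
  have h1 := conj_mul_self_of_norm_eq_one (F.norm_dirP (rho i))
  linear_combination F.dirP (rho i) * h -
    (F.dirPPred i * conj (F.dirP i) * F.dirPPred (rho i)) * h1

theorem T_P (hg : 2 ≤ g) (i : Idx g) : F.T i (F.P i) = F.Q (rho i) := by
  apply F.frame_injective (rho i)
  rw [F.frame_T hg, F.frame_Q hg, ← dirP]
  linear_combination -F.dirPPred (rho i) * conj_mul_self_of_norm_eq_one (F.norm_dirP i)

/-- Unlike `T_P`, which only says that side `i` goes to side `sigma i` reversed, this needs the
supplementary angles. -/
theorem T_P_pred (hg : 2 ≤ g) (i : Idx g) : F.T i (F.P (i - 1)) = F.P (rho i) := by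
  apply F.frame_injective (rho i)
  rw [F.frame_T hg, ← dirP, F.dirP_rho hg, ← dirPPred]

theorem T_Q (hg : 2 ≤ g) (i : Idx g) : F.T i (F.Q i) = F.Q (rho i + 1) := by
  apply F.frame_injective (rho i)
  rw [F.frame_T hg, F.frame_Q_succ hg, F.frame_Q hg, F.dirP_rho hg]
  ring

/-- This is `T_Q` for the inverse transformation `T (sigma i)`. -/
theorem T_Q_add_two (hg : 2 ≤ g) (i : Idx g) : F.T i (F.Q (i + 2)) = F.Q (sigma i) := by
  have h := F.T_Q hg (sigma i)
  rw [rho_sigma hg, add_assoc, one_add_one_eq_two] at h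
  have h2 := F.T_sigma (sigma i)
  rw [sigma_sigma hg] at h2
  rw [← h, ← Equiv.Perm.mul_apply, h2, Equiv.Perm.one_apply]

end SurfacePolygon

/-! ### Lifting Möbius transformations to angles -/

theorem circlePoint_eq_iff {x y : ℝ} :
    circlePoint x = circlePoint y ↔ ∃ n : ℤ, x = y + n * (2 * Real.pi) := by
  rw [Subtype.ext_iff, coe_circlePoint, coe_circlePoint, Complex.exp_eq_exp_iff_exists_int]
  refine exists_congr fun n => ?_
  have e : (y : ℂ) * Complex.I + n * (2 * Real.pi * Complex.I) =
      ((y + n * (2 * Real.pi) : ℝ) : ℂ) * Complex.I := by push_cast; ring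
  rw [e, mul_left_inj' Complex.I_ne_zero, Complex.ofReal_inj]

theorem eq_of_circlePoint_eq {x y : ℝ} (h : circlePoint x = circlePoint y)
    (hxy : |x - y| < 2 * Real.pi) : x = y := by
  obtain ⟨n, hn⟩ := circlePoint_eq_iff.mp h
  have hpi := Real.two_pi_pos
  rw [hn, add_sub_cancel_left, abs_mul, abs_of_pos hpi] at hxy
  have h1 : |(n : ℝ)| < 1 := by
    by_contra! h2
    nlinarith
  have h2 : n = 0 := Int.abs_lt_one_iff.mp (by exact_mod_cast h1)
  rw [hn, h2]
  simp

theorem eq_of_circlePoint_eq_of_mem_Ico {c x y : ℝ} (h : circlePoint x = circlePoint y)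
    (hx : x ∈ Set.Ico c (c + 2 * Real.pi)) (hy : y ∈ Set.Ico c (c + 2 * Real.pi)) : x = y :=
  eq_of_circlePoint_eq h (abs_lt.mpr ⟨by linarith [hx.1, hy.2], by linarith [hx.2, hy.1]⟩)

theorem exists_circlePoint_eq {z : ClosedDisk} (hz : ‖(z : ℂ)‖ = 1) (c : ℝ) :
    ∃ θ ∈ Set.Ico c (c + 2 * Real.pi), z = circlePoint θ := by
  refine ⟨toIcoMod Real.two_pi_pos c (Complex.arg z), toIcoMod_mem_Ico _ _ _, ?_⟩
  have h : z = circlePoint (Complex.arg z) := Subtype.ext (by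
    rw [coe_circlePoint]
    simpa [hz] using (Complex.norm_mul_exp_arg_mul_I (z : ℂ)).symm)
  conv_lhs => rw [h]
  refine circlePoint_eq_iff.mpr ⟨toIcoDiv Real.two_pi_pos c (Complex.arg z), ?_⟩
  rw [← zsmul_eq_mul]
  exact (toIcoMod_add_toIcoDiv_zsmul _ _ _).symm

theorem mem_arc_iff {α β : ℝ} (h1 : α ≤ β) (h2 : β < α + 2 * Real.pi) {x : ClosedDisk} :
    x ∈ arc (circlePoint α) (circlePoint β) ↔ ∃ θ ∈ Set.Icc α β, x = circlePoint θ := by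
  constructor
  · rintro ⟨s, θ, t, hs, ht, hst, e1, e2, e3⟩
    obtain ⟨n, hn⟩ := circlePoint_eq_iff.mp (Subtype.ext e1 : circlePoint α = circlePoint s)
    have e4 : circlePoint β = circlePoint (t + n * (2 * Real.pi)) :=
      (Subtype.ext e3 : circlePoint β = circlePoint t).trans
        (circlePoint_eq_iff.mpr ⟨-n, by push_cast; ring⟩)
    have e5 := eq_of_circlePoint_eq_of_mem_Ico e4 (c := α) ⟨h1, h2⟩
      ⟨by linarith, by linarith⟩
    refine ⟨θ + n * (2 * Real.pi), ⟨by linarith, by linarith⟩,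
      (Subtype.ext e2 : x = circlePoint θ).trans
        (circlePoint_eq_iff.mpr ⟨-n, by push_cast; ring⟩)⟩
  · rintro ⟨θ, ⟨h3, h4⟩, rfl⟩
    exact ⟨α, θ, β, h3, h4, h2, rfl, rfl, rfl⟩

/-- A Möbius transformation lifts to an increasing function of the angle. -/
theorem IsMobius.exists_lift {T : Equiv.Perm ClosedDisk} (hT : IsMobius T) {c c' : ℝ}
    (hc : T (circlePoint c) = circlePoint c') :
    ∃ φ : ℝ → ℝ, StrictMonoOn φ (Set.Ico c (c + 2 * Real.pi)) ∧
      (∀ θ, φ θ ∈ Set.Ico c' (c' + 2 * Real.pi)) ∧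
      ∀ θ, T (circlePoint θ) = circlePoint (φ θ) := by
  obtain ⟨a, b, hab, h⟩ := hT.exists_mob
  have hn : ∀ θ, ‖(T (circlePoint θ) : ℂ)‖ = 1 := fun θ => by
    rw [h]
    exact norm_mob_of_norm_eq_one hab (norm_circlePoint θ)
  choose φ hφ hφT using fun θ => exists_circlePoint_eq (hn θ) c'
  have hpi := Real.two_pi_pos
  have hφc : φ c = c' := eq_of_circlePoint_eq_of_mem_Ico ((hφT c).symm.trans hc) (hφ c)
    ⟨le_rfl, by linarith⟩
  refine ⟨φ, fun x hx y hy hxy => ?_, hφ, hφT⟩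
  have hne : ∀ u v, u ∈ Set.Ico c (c + 2 * Real.pi) → v ∈ Set.Ico c (c + 2 * Real.pi) →
      φ u = φ v → u = v := fun u v hu hv huv =>
    eq_of_circlePoint_eq_of_mem_Ico (T.injective ((hφT u).trans (huv ▸ (hφT v).symm))) hu hv
  have hcm : c ∈ Set.Ico c (c + 2 * Real.pi) := ⟨le_rfl, by linarith⟩
  have hpos : ∀ z ∈ Set.Ico c (c + 2 * Real.pi), c < z → c' < φ z := fun z hz hcz =>
    lt_of_le_of_ne (hφ z).1 fun h0 => hcz.ne (hne _ _ hcm hz (hφc.trans h0))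
  rcases hx.1.eq_or_lt with h0 | h0
  · rw [← h0, hφc]
    exact hpos y hy (h0 ▸ hxy)
  -- The sign of `side` on three points of the circle is their cyclic orientation. It is preserved,
  -- and with `φ c = c'` as base point it forces `φ x < φ y`.
  obtain ⟨k, hk, e⟩ := side_mob hab (norm_circlePoint c) (norm_circlePoint x)
    (norm_circlePoint y).le
  rw [← h, ← h, ← h, hφT, hφT, hφT, hφc] at e
  have hs := mul_pos hk (side_exp_pos h0 hxy hy.2)
  rw [← coe_circlePoint, ← coe_circlePoint, ← coe_circlePoint, ← e, coe_circlePoint,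
    coe_circlePoint, coe_circlePoint, side_exp] at hs
  have h1 := hpos x hx h0
  have h2 := hpos y hy (h0.trans hxy)
  have s1 := sin_half_pos (x := φ x - c') (by linarith) (by linarith [(hφ x).2])
  have s2 := sin_half_pos (x := φ y - c') (by linarith) (by linarith [(hφ y).2])
  by_contra! hle
  have s3 : 0 ≤ Real.sin ((φ x - φ y) / 2) :=
    Real.sin_nonneg_of_nonneg_of_le_pi (by linarith) (by linarith [(hφ x).2])
  rw [show (φ y - φ x) / 2 = -((φ x - φ y) / 2) by ring, Real.sin_neg] at hs
  have : 0 ≤ 8 * Real.sin ((φ x - c') / 2) * Real.sin ((φ x - φ y) / 2) *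
    Real.sin ((φ y - c') / 2) := by positivity
  linarith

/-! ### Cross ratios and contraction -/

/-- Distances change by one factor per endpoint; these factors cancel in a cross ratio. -/
theorem IsMobius.norm_sub_mul {T : Equiv.Perm ClosedDisk} (hT : IsMobius T) :
    ∃ m : ClosedDisk → ℝ, (∀ z, 0 < m z) ∧
      ∀ z w : ClosedDisk, ‖(T z : ℂ) - T w‖ * (m z * m w) = ‖(z : ℂ) - w‖ := by
  obtain ⟨a, b, hab, h⟩ := hT.exists_mob
  have hΔ := normSq_det_pos hab
  have hD : ‖a * (starRingEnd ℂ) a - b * (starRingEnd ℂ) b‖ =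
      Complex.normSq a - Complex.normSq b := by
    rw [Complex.mul_conj, Complex.mul_conj, ← Complex.ofReal_sub, Complex.norm_real,
      Real.norm_of_nonneg hΔ.le]
  have hs := Real.sqrt_pos.mpr hΔ
  refine ⟨fun z => ‖(starRingEnd ℂ) b * z + (starRingEnd ℂ) a‖ /
    √(Complex.normSq a - Complex.normSq b), fun z => div_pos
      (norm_pos_iff.mpr (mob_den_ne_zero hab (norm_coe_le_one z))) hs, fun z w => ?_⟩
  have e := congrArg norm (mob_sub hab (norm_coe_le_one z) (norm_coe_le_one w))
  rw [norm_mul, norm_mul, norm_mul, hD] at e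
  rw [h, h, div_mul_div_comm, Real.mul_self_sqrt hΔ.le, mul_div_assoc', e,
    mul_div_cancel_left₀ _ hΔ.ne']

theorem norm_circlePoint_sub {x y : ℝ} (h0 : x < y) (h1 : y < x + 2 * Real.pi) :
    ‖(circlePoint y : ℂ) - circlePoint x‖ = 2 * Real.sin ((y - x) / 2) := by
  have hs := sin_half_pos (x := y - x) (by linarith) (by linarith)
  have e : (circlePoint y : ℂ) - circlePoint x =
      circlePoint x * (Complex.exp (Complex.I * (y - x : ℝ)) - 1) := by
    rw [coe_circlePoint, coe_circlePoint, mul_sub, ← Complex.exp_add]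
    push_cast
    ring_nf
  rw [e, norm_mul, norm_circlePoint, one_mul, Complex.norm_exp_I_mul_ofReal_sub_one,
    Real.norm_of_nonneg (by linarith)]

/-- The cross ratio of four points of the circle with angles `l < x < y < r < l + 2 π`. -/
noncomputable def crossRatio (l x y r : ℝ) : ℝ :=
  (Real.sin ((y - l) / 2) * Real.sin ((r - x) / 2)) /
    (Real.sin ((x - l) / 2) * Real.sin ((r - y) / 2))

theorem IsMobius.crossRatio_eq {T : Equiv.Perm ClosedDisk} (hT : IsMobius T) {ψ : ℝ → ℝ}
    (hψ : ∀ θ, T (circlePoint θ) = circlePoint (ψ θ)) {l x y r : ℝ} (h1 : l < x) (h2 : x < y)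
    (h3 : y < r) (h4 : r < l + 2 * Real.pi) (h1' : ψ l < ψ x) (h2' : ψ x < ψ y)
    (h3' : ψ y < ψ r) (h4' : ψ r < ψ l + 2 * Real.pi) :
    crossRatio (ψ l) (ψ x) (ψ y) (ψ r) = crossRatio l x y r := by
  obtain ⟨m, hm, e⟩ := hT.norm_sub_mul
  have key : ∀ u v, u < v → v < u + 2 * Real.pi → ψ u < ψ v → ψ v < ψ u + 2 * Real.pi →
      Real.sin ((v - u) / 2) =
        Real.sin ((ψ v - ψ u) / 2) * (m (circlePoint v) * m (circlePoint u)) := by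
    intro u v a1 a2 a3 a4
    have := e (circlePoint v) (circlePoint u)
    rw [hψ, hψ, norm_circlePoint_sub a1 a2, norm_circlePoint_sub a3 a4] at this
    linarith
  have s1 := sin_half_pos (x := ψ x - ψ l) (by linarith) (by linarith)
  have s2 := sin_half_pos (x := ψ r - ψ y) (by linarith) (by linarith)
  have := hm (circlePoint l)
  have := hm (circlePoint x)
  have := hm (circlePoint y)
  have := hm (circlePoint r)
  unfold crossRatio
  rw [key l y (by linarith) (by linarith) (by linarith) (by linarith),
    key x r (by linarith) (by linarith) (by linarith) (by linarith),
    key l x (by linarith) (by linarith) (by linarith) (by linarith),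
    key y r (by linarith) (by linarith) (by linarith) (by linarith)]
  rw [div_eq_div_iff (by positivity) (by positivity)]
  ring

/-- Ptolemy's theorem for four points on a circle separated by arcs `2p`, `2q`, `2r`. -/
theorem sin_mul_sin_sub (p q r : ℝ) :
    Real.sin (p + q) * Real.sin (q + r) - Real.sin q * Real.sin (p + q + r) =
      Real.sin p * Real.sin r := by
  have hq := Real.sin_sq_add_cos_sq q
  rw [Real.sin_add (p + q), Real.sin_add p, Real.cos_add p, Real.sin_add q]
  linear_combination Real.sin p * Real.sin r * hq

/-- The Hilbert distance of two points grows when the surrounding arc shrinks. Moving the left end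
alone already makes this strict. -/
theorem crossRatio_lt {l l' x y r r' : ℝ} (h0 : l < l') (h1 : l' < x) (h2 : x < y) (h3 : y < r')
    (h4 : r' ≤ r) (h5 : r < l + 2 * Real.pi) : crossRatio l x y r < crossRatio l' x y r' := by
  have s1 := sin_half_pos (x := x - l) (by linarith) (by linarith)
  have s2 := sin_half_pos (x := x - l') (by linarith) (by linarith)
  have s3 := sin_half_pos (x := r - y) (by linarith) (by linarith)
  have s4 := sin_half_pos (x := r' - y) (by linarith) (by linarith)
  have s5 := sin_half_pos (x := r - x) (by linarith) (by linarith)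
  have s6 := sin_half_pos (x := y - l') (by linarith) (by linarith)
  have s7 := sin_half_pos (x := y - x) (by linarith) (by linarith)
  have s8 := sin_half_pos (x := l' - l) (by linarith) (by linarith)
  have s9 : 0 ≤ Real.sin ((r - r') / 2) :=
    Real.sin_nonneg_of_nonneg_of_le_pi (by linarith) (by linarith)
  have d1 := sin_mul_sin_sub ((l' - l) / 2) ((x - l') / 2) ((y - x) / 2)
  have d2 := sin_mul_sin_sub ((y - x) / 2) ((r' - y) / 2) ((r - r') / 2)
  rw [show (l' - l) / 2 + (x - l') / 2 = (x - l) / 2 by ring,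
    show (x - l') / 2 + (y - x) / 2 = (y - l') / 2 by ring,
    show (x - l) / 2 + (y - x) / 2 = (y - l) / 2 by ring] at d1
  rw [show (y - x) / 2 + (r' - y) / 2 = (r' - x) / 2 by ring,
    show (r' - y) / 2 + (r - r') / 2 = (r - y) / 2 by ring,
    show (r' - x) / 2 + (r - r') / 2 = (r - x) / 2 by ring] at d2
  have p1 := mul_pos s8 s7
  have p2 := mul_nonneg s7.le s9
  have q1 : Real.sin ((y - l) / 2) / Real.sin ((x - l) / 2) <
      Real.sin ((y - l') / 2) / Real.sin ((x - l') / 2) := by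
    rw [div_lt_div_iff₀ s1 s2]; linarith
  have q2 : Real.sin ((r - x) / 2) / Real.sin ((r - y) / 2) ≤
      Real.sin ((r' - x) / 2) / Real.sin ((r' - y) / 2) := by
    rw [div_le_div_iff₀ s3 s4]; linarith
  unfold crossRatio
  rw [mul_div_mul_comm, mul_div_mul_comm]
  exact mul_lt_mul q1 q2 (div_pos s5 s3) (div_pos s6 s2).le

/-! ### Fixed points of systems of arc maps -/

/-- Arcs `[A k, B k]` inside larger arcs `[L k, R k]`, and lifts `ψ k` of Möbius transformations
`T k` carrying the arcs with index `f k` into the arcs with index `k`. -/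
structure ArcSystem {ι : Type*} (f : ι → ι) (T : ι → Equiv.Perm ClosedDisk) (ψ : ι → ℝ → ℝ)
    (L A B R : ι → ℝ) : Prop where
  L_lt : ∀ k, L k < A k
  A_lt : ∀ k, A k < B k
  B_lt : ∀ k, B k < R k
  R_lt : ∀ k, R k < L k + 2 * Real.pi
  mobius : ∀ k, IsMobius (T k)
  lift : ∀ k θ, T k (circlePoint θ) = circlePoint (ψ k θ)
  mono : ∀ k, StrictMonoOn (ψ k) (Set.Icc (L (f k)) (R (f k)))
  map_L : ∀ k, L k < ψ k (L (f k))
  map_A : ∀ k, A k ≤ ψ k (A (f k))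
  map_B : ∀ k, ψ k (B (f k)) ≤ B k
  map_R : ∀ k, ψ k (R (f k)) ≤ R k

namespace ArcSystem

variable {ι : Type*} {f : ι → ι} {T : ι → Equiv.Perm ClosedDisk} {ψ : ι → ℝ → ℝ}
  {L A B R : ι → ℝ}

theorem mem_Icc (h : ArcSystem f T ψ L A B R) {k : ι} {θ : ℝ} (hθ : θ ∈ Set.Icc (A k) (B k)) :
    θ ∈ Set.Icc (L k) (R k) :=
  ⟨(h.L_lt k).le.trans hθ.1, hθ.2.trans (h.B_lt k).le⟩

theorem map_mem_Icc (h : ArcSystem f T ψ L A B R) {k : ι} {θ : ℝ}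
    (hθ : θ ∈ Set.Icc (A (f k)) (B (f k))) : ψ k θ ∈ Set.Icc (A k) (B k) := by
  have hA := h.mem_Icc (Set.left_mem_Icc.mpr (h.A_lt (f k)).le)
  have hB := h.mem_Icc (Set.right_mem_Icc.mpr (h.A_lt (f k)).le)
  exact ⟨(h.map_A k).trans ((h.mono k).monotoneOn hA (h.mem_Icc hθ) hθ.1),
    ((h.mono k).monotoneOn (h.mem_Icc hθ) hB hθ.2).trans (h.map_B k)⟩

/-- Knaster–Tarski on the complete lattice of families of angles; no continuity of the lifts is
needed. -/
theorem exists_fixed (h : ArcSystem f T ψ L A B R) :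
    ∃ θ : ι → ℝ, (∀ k, θ k ∈ Set.Icc (A k) (B k)) ∧ ∀ k, θ k = ψ k (θ (f k)) := by
  have hAB : ∀ k, Fact (A k ≤ B k) := fun k => ⟨(h.A_lt k).le⟩
  let Φ : (∀ k, Set.Icc (A k) (B k)) →o (∀ k, Set.Icc (A k) (B k)) :=
    { toFun := fun x k => ⟨ψ k (x (f k)), h.map_mem_Icc (x (f k)).2⟩
      monotone' := fun x y hxy k =>
        (h.mono k).monotoneOn (h.mem_Icc (x (f k)).2) (h.mem_Icc (y (f k)).2) (hxy (f k)) }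
  refine ⟨fun k => (Φ.lfp k : ℝ), fun k => (Φ.lfp k).2, fun k => ?_⟩
  exact congrArg Subtype.val (congrFun Φ.map_lfp.symm k)

/-- Among the indices where `x < y`, take one, `m`, with the largest cross ratio. Then `f m` is such
an index too. Its cross ratio, carried by `T m` into a strictly smaller arc than `[L m, R m]`,
exceeds that at `m`, a contradiction. -/
theorem le_of_fixed [Finite ι] (h : ArcSystem f T ψ L A B R) {x y : ι → ℝ}
    (hx : ∀ k, x k ∈ Set.Icc (A k) (B k)) (hy : ∀ k, y k ∈ Set.Icc (A k) (B k))
    (hfx : ∀ k, x k = ψ k (x (f k))) (hfy : ∀ k, y k = ψ k (y (f k))) (k : ι) : y k ≤ x k := by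
  by_contra! hk
  obtain ⟨m, hm, hmax⟩ := Set.exists_max_image {k | x k < y k}
    (fun k => crossRatio (L k) (x k) (y k) (R k)) (Set.toFinite _) ⟨k, hk⟩
  have hxm := h.mem_Icc (hx (f m))
  have hym := h.mem_Icc (hy (f m))
  have hm' : x (f m) < y (f m) := by
    by_contra! hle
    have := (h.mono m).monotoneOn hym hxm hle
    rw [← hfx, ← hfy] at this
    exact absurd hm (not_lt.mpr this)
  refine absurd (hmax (f m) hm') (not_le.mpr ?_)
  have l1 := (h.L_lt (f m)).trans_le (hx (f m)).1
  have l2 := (hy (f m)).2.trans_lt (h.B_lt (f m))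
  have hLR : L (f m) ≤ R (f m) := (l1.trans (hm'.trans l2)).le
  have m1 := h.mono m (Set.left_mem_Icc.mpr hLR) hxm l1
  have m2 := h.mono m hxm hym hm'
  have m3 := h.mono m hym (Set.right_mem_Icc.mpr hLR) l2
  have e := (h.mobius m).crossRatio_eq (h.lift m) l1 hm' l2 (h.R_lt _) m1 m2 m3
    (by linarith [h.map_L m, h.map_R m, h.R_lt m])
  rw [← e]
  rw [← hfx] at m1 m2 ⊢
  rw [← hfy] at m2 m3 ⊢
  exact crossRatio_lt (h.map_L m) m1 m2 m3 (h.map_R m) (h.R_lt m)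

theorem existsUnique [Finite ι] (h : ArcSystem f T ψ L A B R) :
    ∃! G : ι → ClosedDisk,
      ∀ k, (∃ θ ∈ Set.Icc (A k) (B k), G k = circlePoint θ) ∧ G k = T k (G (f k)) := by
  obtain ⟨x, hx, hfx⟩ := h.exists_fixed
  refine ⟨fun k => circlePoint (x k), fun k => ⟨⟨x k, hx k, rfl⟩, ?_⟩, fun G hG => ?_⟩
  · beta_reduce
    rw [h.lift, ← hfx]
  choose y hy hGy using fun k => (hG k).1
  have hfy : ∀ k, y k = ψ k (y (f k)) := fun k => by
    have e : circlePoint (y k) = circlePoint (ψ k (y (f k))) := by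
      rw [← hGy, (hG k).2, hGy, h.lift]
    have h1 := h.map_mem_Icc (hy (f k))
    have h2 := h.mem_Icc (hy k)
    have h3 := h.mem_Icc h1
    have h4 := h.R_lt k
    exact eq_of_circlePoint_eq_of_mem_Ico e (c := L k) ⟨h2.1, h2.2.trans_lt h4⟩
      ⟨h3.1, h3.2.trans_lt h4⟩
  funext k
  rw [hGy, le_antisymm (h.le_of_fixed hx hy hfx hfy k) (h.le_of_fixed hy hx hfy hfx k)]

end ArcSystem

/-! ### The side pairings act on arcs -/

/-- `T` has an increasing lift carrying `[a μ, a (μ + 1)]` into `[a κ, a (κ + 1)]` and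
`[b (μ - 1), b (μ + 1)]` into `(b (κ - 1), b (κ + 1)]`. -/
def LiftsArc (a b : ℤ → ℝ) (T : Equiv.Perm ClosedDisk) (μ κ : ℤ) : Prop :=
  ∃ ψ : ℝ → ℝ, (∀ θ, T (circlePoint θ) = circlePoint (ψ θ)) ∧
    StrictMonoOn ψ (Set.Icc (b (μ - 1)) (b (μ + 1))) ∧ b (κ - 1) < ψ (b (μ - 1)) ∧
    a κ ≤ ψ (a μ) ∧ ψ (a (μ + 1)) ≤ a (κ + 1) ∧ ψ (b (μ + 1)) ≤ b (κ + 1)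

namespace SurfacePolygon

variable {g : ℕ} (F : SurfacePolygon g)

/-- The circle is cut at `Q (m + 2)`, whose image is `Q s`. Its angle is taken one turn back, so
that all points needed lie within the turn after the cut. -/
theorem exists_lift_T (hg : 2 ≤ g) {a b : ℤ → ℝ} (h : IsAngleLift F.P F.Q a b) {m s : ℤ}
    (hs : (s : Idx g) = sigma (m : Idx g)) :
    ∃ φ : ℝ → ℝ, (∀ θ, F.T (m : Idx g) (circlePoint θ) = circlePoint (φ θ)) ∧
      StrictMonoOn φ (Set.Ico (b (m + 2 - (8 * g - 4))) (b (m + 2))) ∧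
      φ (b (m + 2 - (8 * g - 4))) = b s ∧ φ (a (m - 1)) = a (s + 1) ∧ φ (a m) = b (s + 1) ∧
      φ (b m) = b (s + 2) := by
  have hN := cast_size hg
  have hb := h.b_add
  rw [hN] at hb
  have e2 : b (m + 2) = b (m + 2 - (8 * g - 4)) + 2 * Real.pi := by
    rw [← hb, sub_add_cancel]
  have hr : rho (m : Idx g) = ((s + 1 : ℤ) : Idx g) := by
    rw [rho, ← hs]
    push_cast
    rfl
  have hc : F.T (m : Idx g) (circlePoint (b (m + 2 - (8 * g - 4)))) = circlePoint (b s) := by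
    have h1 := F.T_Q_add_two hg (m : Idx g)
    have e1 : ((m : Idx g) + 2) = ((m + 2 : ℤ) : Idx g) := by push_cast; rfl
    rw [e1, h.Q_eq, ← hs, h.Q_eq, e2] at h1
    rw [← h1]
    exact congrArg _ (circlePoint_eq_iff.mpr ⟨-1, by push_cast; ring⟩)
  have hpi := Real.two_pi_pos
  obtain ⟨φ, hmono, hmem, hφ⟩ := (F.mobius (m : Idx g)).exists_lift hc
  have val : ∀ θ t, F.T (m : Idx g) (circlePoint θ) = circlePoint t → b s ≤ t →
      t < b (s + (8 * g - 4)) → φ θ = t := fun θ t ht h1 h2 =>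
    eq_of_circlePoint_eq_of_mem_Ico ((hφ θ).symm.trans ht) (hmem θ) ⟨h1, by rwa [hb] at h2⟩
  refine ⟨φ, hφ, by rwa [e2], val _ _ hc le_rfl (h.strictMono_b (by omega)),
    val _ _ ?_ (h.lt_succ s).le (h.a_lt_b (by omega)),
    val _ _ ?_ (h.strictMono_b (by omega)).le (h.strictMono_b (by omega)),
    val _ _ ?_ (h.strictMono_b (by omega)).le (h.strictMono_b (by omega))⟩
  · have h1 := F.T_P_pred hg (m : Idx g)
    have e1 : ((m : Idx g) - 1) = ((m - 1 : ℤ) : Idx g) := by push_cast; rfl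
    rwa [hr, e1, h.P_eq, h.P_eq] at h1
  · have h1 := F.T_P hg (m : Idx g)
    rwa [hr, h.P_eq, h.Q_eq] at h1
  · have h1 := F.T_Q hg (m : Idx g)
    have e1 : (((s + 1 : ℤ) : Idx g) + 1) = ((s + 2 : ℤ) : Idx g) := by push_cast; ring
    rwa [hr, e1, h.Q_eq, h.Q_eq] at h1

/-- The case `A i = P i`. The right end `P (m - 1)` goes exactly to the right end `P (s + 1)`, so
the `P`-arcs alone leave no room there. -/
theorem liftsArc_sub_two (hg : 2 ≤ g) {a b : ℤ → ℝ} (h : IsAngleLift F.P F.Q a b) {m s : ℤ}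
    (hs : (s : Idx g) = sigma (m : Idx g)) : LiftsArc a b (F.T (m : Idx g)) (m - 2) s := by
  obtain ⟨φ, hφ, hmono, h0, h1, h2, -⟩ := F.exists_lift_T hg h hs
  have hab : ∀ {k l : ℤ}, k ≤ l → a k < b l := h.a_lt_b
  have hba : ∀ {k l : ℤ}, k < l → b k < a l := h.b_lt_a
  have hbb : ∀ {k l : ℤ}, k < l → b k < b l := fun hkl => h.strictMono_b hkl
  have m0 : b (m + 2 - (8 * g - 4)) ∈ Set.Ico (b (m + 2 - (8 * g - 4))) (b (m + 2)) :=
    ⟨le_rfl, hbb (by omega)⟩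
  have ml : b (m - 2 - 1) ∈ Set.Ico (b (m + 2 - (8 * g - 4))) (b (m + 2)) :=
    ⟨(hbb (by omega)).le, hbb (by omega)⟩
  have mr : b (m - 2 + 1) ∈ Set.Ico (b (m + 2 - (8 * g - 4))) (b (m + 2)) :=
    ⟨(hbb (by omega)).le, hbb (by omega)⟩
  have ma : a (m - 2) ∈ Set.Ico (b (m + 2 - (8 * g - 4))) (b (m + 2)) :=
    ⟨(hba (by omega)).le, hab (by omega)⟩
  have ma' : a m ∈ Set.Ico (b (m + 2 - (8 * g - 4))) (b (m + 2)) :=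
    ⟨(hba (by omega)).le, hab (by omega)⟩
  refine ⟨φ, hφ, hmono.mono fun θ hθ => ⟨ml.1.trans hθ.1, hθ.2.trans_lt mr.2⟩, ?_, ?_, ?_, ?_⟩
  · have := hmono m0 ml (hbb (by omega))
    rw [h0] at this
    exact (hbb (by omega)).trans this
  · have := hmono m0 ma (hba (by omega))
    rw [h0] at this
    exact (h.lt s).le.trans this.le
  · rw [show m - 2 + 1 = m - 1 by ring, h1]
  · have := hmono mr ma' (hba (by omega))
    rw [h2] at this
    exact this.le

/-- The case `A i = Q i`, with `m = tau i + 1`. Here the left ends of the `P`-arcs and the right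
ends of the `Q`-arcs match exactly, which is why only the left end of the larger arc is required to
move strictly. -/
theorem liftsArc_sub_one (hg : 2 ≤ g) {a b : ℤ → ℝ} (h : IsAngleLift F.P F.Q a b) {m s : ℤ}
    (hs : (s : Idx g) = sigma (m : Idx g)) : LiftsArc a b (F.T (m : Idx g)) (m - 1) (s + 1) := by
  obtain ⟨φ, hφ, hmono, h0, h1, h2, h3⟩ := F.exists_lift_T hg h hs
  have hbb : ∀ {k l : ℤ}, k < l → b k < b l := fun hkl => h.strictMono_b hkl
  have m0 : b (m + 2 - (8 * g - 4)) ∈ Set.Ico (b (m + 2 - (8 * g - 4))) (b (m + 2)) :=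
    ⟨le_rfl, hbb (by omega)⟩
  have ml : b (m - 1 - 1) ∈ Set.Ico (b (m + 2 - (8 * g - 4))) (b (m + 2)) :=
    ⟨(hbb (by omega)).le, hbb (by omega)⟩
  have mr : b m < b (m + 2) := hbb (by omega)
  refine ⟨φ, hφ, hmono.mono fun θ hθ => ⟨ml.1.trans hθ.1, ?_⟩, ?_, ?_, ?_, ?_⟩
  · exact (hθ.2.trans_eq (by rw [sub_add_cancel])).trans_lt mr
  · have := hmono m0 ml (hbb (by omega))
    rw [h0] at this
    rwa [add_sub_cancel_right]
  · rw [h1]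
  · rw [sub_add_cancel, h2]
    exact (h.lt_succ _).le
  · rw [sub_add_cancel, h3, add_assoc, one_add_one_eq_two]

theorem P_ne_Q (hg : 2 ≤ g) (i : Idx g) : F.P i ≠ F.Q i := by
  obtain ⟨a, b, h⟩ := F.order.exists_isAngleLift
  obtain ⟨m, rfl⟩ := ZMod.intCast_surjective i
  have hN := cast_size hg
  rw [h.P_eq, h.Q_eq]
  intro h0
  refine (h.lt m).ne (eq_of_circlePoint_eq_of_mem_Ico h0 (c := a m) ⟨le_rfl, ?_⟩
    ⟨(h.lt m).le, ?_⟩)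
  · linarith [Real.two_pi_pos]
  · rw [← h.a_add]
    exact h.b_lt_a (by omega)

end SurfacePolygon

end BowenSeries

/-! ### The extremal system of equations -/

theorem mainTheorem2 (g : ℕ) (hg : 2 ≤ g) (F : BowenSeries.SurfacePolygon g)
    (A : BowenSeries.Idx g → BowenSeries.ClosedDisk) (hA : F.IsExtremal A) :
    ∃! G : BowenSeries.Idx g → BowenSeries.ClosedDisk, ∀ i : BowenSeries.Idx g,
      G i ∈ BowenSeries.arc (F.P i) (F.P (i + 1)) ∧
      (A i = F.P i → G (BowenSeries.sigma i) = F.T i (G (i - 2))) ∧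
      (A i = F.Q i →
        G (BowenSeries.sigma i) =
          F.T (BowenSeries.tau i + 1) (G (BowenSeries.tau i))) := by
  classical
  open BowenSeries in
  have : NeZero (8 * g - 4) := ⟨by omega⟩
  have hN := SurfacePolygon.cast_size hg
  obtain ⟨a, b, h⟩ := F.order.exists_isAngleLift
  obtain ⟨n, hn⟩ : ∃ n : Idx g → ℤ, ∀ k, ((n k : ℤ) : Idx g) = k :=
    ⟨_, Function.surjInv_eq ZMod.intCast_surjective⟩
  -- The equation for index `i` determines `G (sigma i)`. As `sigma` is an involution, reindexing by
  -- `k = sigma i` gives one equation per unknown.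
  obtain ⟨f, hf⟩ : ∃ f : Idx g → Idx g, ∀ k, f k =
      if A (sigma k) = F.P (sigma k) then sigma k - 2 else tau (sigma k) := ⟨_, fun _ => rfl⟩
  obtain ⟨T, hT⟩ : ∃ T : Idx g → Equiv.Perm ClosedDisk, ∀ k, T k =
      if A (sigma k) = F.P (sigma k) then F.T (sigma k) else F.T (tau (sigma k) + 1) :=
    ⟨_, fun _ => rfl⟩
  have hlift : ∀ k, LiftsArc a b (T k) (n (f k)) (n k) := fun k => by
    rw [hT]
    split_ifs with hk
    · have e : ((n (f k) + 2 : ℤ) : Idx g) = sigma k := by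
        push_cast
        rw [hn, hf, if_pos hk, sub_add_cancel]
      have := F.liftsArc_sub_two hg h (m := n (f k) + 2) (s := n k)
        (by rw [e, hn, sigma_sigma hg])
      rwa [e, add_sub_cancel_right] at this
    · have e : ((n (f k) + 1 : ℤ) : Idx g) = tau (sigma k) + 1 := by
        push_cast
        rw [hn, hf, if_neg hk]
      have := F.liftsArc_sub_one hg h (m := n (f k) + 1) (s := n k - 1)
        (by rw [e, sigma_tau_add_one hg, sigma_sigma hg]; push_cast; rw [hn])
      rwa [e, add_sub_cancel_right, sub_add_cancel] at this
  have hmob : ∀ k, IsMobius (T k) := fun k => by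
    rw [hT]
    split_ifs
    exacts [F.mobius _, F.mobius _]
  choose ψ h1 h2 h3 h4 h5 h6 using hlift
  have sys : ArcSystem f T ψ (fun k => b (n k - 1)) (fun k => a (n k)) (fun k => a (n k + 1))
      (fun k => b (n k + 1)) :=
    ⟨fun k => h.b_lt_a (by omega), fun k => h.strictMono_a (by omega), fun k => h.lt _,
      fun k => by rw [← h.b_add]; exact h.strictMono_b (by omega), hmob, h1, h2, h3, h4, h5, h6⟩
  refine (existsUnique_congr fun G => ?_).mp sys.existsUnique
  have harc : ∀ k, G k ∈ arc (F.P k) (F.P (k + 1)) ↔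
      ∃ θ ∈ Set.Icc (a (n k)) (a (n k + 1)), G k = circlePoint θ := fun k => by
    have e1 : F.P k = circlePoint (a (n k)) := by rw [← h.P_eq, hn]
    have e2 : F.P (k + 1) = circlePoint (a (n k + 1)) := by
      rw [← h.P_eq]
      push_cast
      rw [hn]
    rw [e1, e2]
    exact mem_arc_iff (h.strictMono_a (by omega)).le
      (by rw [← h.a_add]; exact h.strictMono_a (by omega))
  -- Extremality and `P i ≠ Q i` make exactly one of the two implications nonvacuous.
  have heq : ∀ i, G (sigma i) = T (sigma i) (G (f (sigma i))) ↔
      (A i = F.P i → G (sigma i) = F.T i (G (i - 2))) ∧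
      (A i = F.Q i → G (sigma i) = F.T (tau i + 1) (G (tau i))) := fun i => by
    rw [hT, hf, sigma_sigma hg]
    by_cases hi : A i = F.P i
    · have hne : A i ≠ F.Q i := hi ▸ F.P_ne_Q hg i
      simp only [hi, if_true, true_imp_iff, F.P_ne_Q hg i, false_imp_iff, and_true]
    · have hq := (hA i).resolve_left hi
      simp only [if_false, hq, true_imp_iff, (F.P_ne_Q hg i).symm, false_imp_iff, true_and]
  constructor
  · exact fun hG i => ⟨(harc i).mpr (hG i).1, (heq i).mp (hG (sigma i)).2⟩
  · refine fun hG k => ⟨(harc k).mp (hG k).1, ?_⟩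
    have := (heq (sigma k)).mpr (hG (sigma k)).2
    rwa [sigma_sigma hg] at this
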